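/- **Theorem 1.3 (Improved Kato inequalities).** Setting. Let $\mathbb H^n=\mathbb R^{2n+1}$ with coordinates $(x,y,t)$ be the Heisenberg group with left-invariant frame $X_j=\partial_{x_j}+y_j\partial_t$, $Y_j=\partial_{y_j}-x_j\partial_t$ $(1\le j\le n)$, $T=\partial_t$, the Riemannian metric $\langle\cdot,\cdot\rangle$ for which this frame is orthonormal, the horizontal distribution $\mathcal H=\mathrm{span}\{X_j,Y_j\}$, and the complex structure $J(X_j)=Y_j$, $J(Y_j)=-X_j$, $J(T)=0$. Let $\nabla$ be the pseudohermitian connection, i.e. the unique metric connection with $\nabla_XY-\nabla_YX-[X,Y]=2\langle J(X),Y\rangle T$; the left-invariant frame is parallel for it. Let $S$ be a smooth, immersed hypersurface (without boundary) in $\mathbb H^n$. A point $p\in S$ is characteristic if $T_pS=\mathcal H_p$. On the non-characteristic part of $S$, let $N$ be a local Riemannian unit normal, $N^{\mathbb H}=N-\langle N,T\rangle T$, $\nu=N^{\mathbb H}/|N^{\mathbb H}|$, $\alpha=\langle N,T\rangle/|N^{\mathbb H}|$, $\mathcal HTS=\mathcal H\cap TS$ (of rank $2n-1$, containing $J(\nu)$)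 and $\mathcal H'TS=\mathcal HTS\cap J(\mathcal HTS)$. Put $$h(X,Y)=\langle\nabla_X\nu,Y\rangle,\qquad \tilde h(X,Y)=\langle\nabla_X\nu+\alpha J'(X),Y\rangle,\qquad \ell=h(J(\nu),J(\nu))$$ for $X,Y\in\mathcal HTS$, where $J'=J$ on $\mathcal H'TS$ and $J'(J(\nu))=0$, and $H=\operatorname{tr}h$. For horizontal tangent fields let $\nabla^S_XY=\nabla_XY-\langle\nabla_XY,\nu\rangle\nu$ and $\nabla^S_X\tilde h(Y,Z)=X(\tilde h(Y,Z))-\tilde h(\nabla^S_XY,Z)-\tilde h(Y,\nabla^S_XZ)$. For any local orthonormal frame $E_1,\dots,E_{2n-1}$ of $\mathcal HTS$ let $\nabla^{\mathcal H,S}f=\sum_j(E_jf)E_j$, $|\tilde h|^2=\sum_{i,j}\tilde h(E_i,E_j)^2$ and $|\nabla^{\mathcal H,S}\tilde h|^2=\sum_{i,j,k}\big(\nabla^S_{E_i}\tilde h(E_j,E_k)\big)^2$. Statement. On the non-characteristic part of $S$, $$\big|\nabla^{\mathcal H,S}|\tilde h|^2\big|^2\le 4|\tilde h|^2\,|\nabla^{\mathcal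 H,S}\tilde h|^2 .$$ Assume in addition that, on the non-characteristic part of $S$, $S$ is minimal ($H\equiv0$) and satisfies (P1) $\nabla_{J(\nu)}\nu-\ell J(\nu)\equiv 0$, and (P2) $\nabla^{\mathcal H,S}\alpha\equiv\langle\nabla\alpha,J(\nu)\rangle J(\nu)$, where $\langle\nabla\alpha,J(\nu)\rangle$ is the derivative of $\alpha$ along $J(\nu)$. Then, for every $k\in[0,2]$, on the non-characteristic part of $S$, $$\Big(1+\frac{k}{2n-1}\Big)\big|\nabla^{\mathcal H,S}|\tilde h|^2\big|^2\le 4|\tilde h|^2|\nabla^{\mathcal H,S}\tilde h|^2+4\alpha^2|\tilde h|^2\Big((4k-2)|\tilde h|^2+(2+2kn-2k-4n)\ell^2\Big).$$ -/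

import Mathlib

open scoped Manifold ContDiff

noncomputable section

namespace Heisenberg

/-! ## The Heisenberg group, its left-invariant frame and the pseudohermitian connection -/

/-- The points `(x, y, t)` of the Heisenberg group `ℍⁿ = ℝ²ⁿ⁺¹`. Only the smooth structure of this
vector space is used; the metric is introduced below through the left-invariant frame. -/
abbrev Point (n : ℕ) : Type := (Fin n → ℝ) × (Fin n → ℝ) × ℝ

/-- Labels of the left-invariant frame: `inl (inl i)` is `X_i`, `inl (inr i)` is `Y_i`, and
`inr ()` is `T`. -/
abbrev Idx (n : ℕ) : Type := (Fin n ⊕ Fin n) ⊕ Unit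

/-- The left-invariant frame `X_i = ∂_{x_i} + y_i ∂_t`, `Y_i = ∂_{y_i} - x_i ∂_t`, `T = ∂_t`. -/
def Z {n : ℕ} : Idx n → Point n → Point n
  | Sum.inl (Sum.inl i) => fun q => (Pi.single i 1, 0, q.2.1 i)
  | Sum.inl (Sum.inr i) => fun q => (0, Pi.single i 1, -q.1 i)
  | Sum.inr _ => fun _ => (0, 0, 1)

/-- Tangent vectors of `ℍⁿ`, written through their coefficients in the left-invariant frame.
The metric that makes the frame orthonormal is the Euclidean inner product of `Vec n`. -/
abbrev Vec (n : ℕ) : Type := EuclideanSpace ℝ (Idx n)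

/-- The coefficients, in the left-invariant frame at `q`, of the tangent vector `w` at `q`. -/
def coeff {n : ℕ} (q : Point n) : Point n →ₗ[ℝ] Vec n where
  toFun w := WithLp.toLp 2 (fun
    | Sum.inl (Sum.inl i) => w.1 i
    | Sum.inl (Sum.inr i) => w.2.1 i
    | Sum.inr _ => w.2.2 - ∑ i, (q.2.1 i * w.1 i - q.1 i * w.2.1 i))
  map_add' v w := by
    ext j
    rcases j with (i | i) | i
    · simp
    · simp
    · simp only [Prod.snd_add, Prod.fst_add, Pi.add_apply, PiLp.add_apply, mul_add,
        Finset.sum_sub_distrib, Finset.sum_add_distrib]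
      ring
  map_smul' c w := by
    ext j
    rcases j with (i | i) | i
    · simp
    · simp
    · simp only [Prod.smul_snd, Prod.smul_fst, Pi.smul_apply, PiLp.smul_apply, smul_eq_mul,
        RingHom.id_apply, mul_sub, Finset.mul_sum]
      congr 2
      ext i
      ring

theorem sum_coeff_smul_Z {n : ℕ} (q w : Point n) : ∑ j, coeff q w j • Z j q = w := by
  refine Prod.ext ?_ (Prod.ext ?_ ?_)
  · ext i
    simp [Prod.fst_sum, coeff, Z, Finset.sum_apply, Pi.single_apply]
  · ext i
    simp [Prod.fst_sum, Prod.snd_sum, coeff, Z, Finset.sum_apply, Pi.single_apply]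
  · simp [Prod.snd_sum, coeff, Z, Finset.sum_sub_distrib, mul_comm]
    ring

theorem coeff_Z {n : ℕ} (q : Point n) (j : Idx n) :
    coeff q (Z j q) = EuclideanSpace.single j (1 : ℝ) := by
  ext k
  rcases j with (i | i) | i <;> rcases k with (l | l) | l <;>
    simp [coeff, Z, Pi.single_apply]

/-- The vector `T`. -/
def T {n : ℕ} : Vec n := EuclideanSpace.single (Sum.inr ()) 1

/-- The complex structure: `J X_i = Y_i`, `J Y_i = -X_i`, `J T = 0`. -/
def J {n : ℕ} : Vec n →ₗ[ℝ] Vec n where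
  toFun v := WithLp.toLp 2 (fun
    | Sum.inl (Sum.inl i) => -v (Sum.inl (Sum.inr i))
    | Sum.inl (Sum.inr i) => v (Sum.inl (Sum.inl i))
    | Sum.inr _ => 0)
  map_add' v w := by
    ext j
    rcases j with (i | i) | i <;> simp [add_comm]
  map_smul' c w := by
    ext j
    rcases j with (i | i) | i <;> simp

/-- The horizontal distribution `𝓗`, spanned by the `X_i` and the `Y_i`. -/
def horizontal (n : ℕ) : Submodule ℝ (Vec n) :=
  Submodule.span ℝ (Set.range fun i : Fin n ⊕ Fin n => EuclideanSpace.single (Sum.inl i) (1 : ℝ))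

/-- The pseudohermitian connection `∇_w Y` of `ℍⁿ` at `q`, for a tangent vector `w` at `q` and a
vector field `Y`: the connection for which the left-invariant frame is parallel. That it is the
unique metric connection with torsion `2 ⟨J X, Y⟩ T` is `isPseudohermitian_iff` below. -/
def nabla {n : ℕ} (Y : Point n → Point n) (q w : Point n) : Point n :=
  ∑ j, (fderiv ℝ (fun q' => coeff q' (Y q') j) q w) • Z j q

/-- `D`, where `D X Y = D_X Y`, is metric and has torsion
`D_X Y - D_Y X - [X, Y] = 2 ⟨J X, Y⟩ T`. -/
structure IsPseudohermitian {n : ℕ}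
    (D : (Point n → Point n) → (Point n → Point n) → Point n → Point n) : Prop where
  metric : ∀ X Y W : Point n → Point n, ContDiff ℝ ∞ X → ContDiff ℝ ∞ Y → ContDiff ℝ ∞ W →
    ∀ q, fderiv ℝ (fun q' => inner ℝ (coeff q' (Y q')) (coeff q' (W q'))) q (X q) =
      inner ℝ (coeff q (D X Y q)) (coeff q (W q)) + inner ℝ (coeff q (Y q)) (coeff q (D X W q))
  torsion : ∀ X Y : Point n → Point n, ContDiff ℝ ∞ X → ContDiff ℝ ∞ Y → ∀ q,
    D X Y q - D Y X q - VectorField.lieBracket ℝ X Y q =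
      (2 * inner ℝ (J (coeff q (X q))) (coeff q (Y q))) • Z (Sum.inr ()) q

theorem coeff_nabla {n : ℕ} (Y : Point n → Point n) (q w : Point n) (j : Idx n) :
    coeff q (nabla Y q w) j = fderiv ℝ (fun q' => coeff q' (Y q') j) q w := by
  simp only [nabla, map_sum, map_smul, coeff_Z, WithLp.ofLp_sum, Finset.sum_apply, PiLp.smul_apply,
    PiLp.single_apply, smul_eq_mul, mul_ite, mul_one, mul_zero]
  simp

theorem contDiff_coeff {n : ℕ} {Y : Point n → Point n} (hY : ContDiff ℝ ∞ Y) (j : Idx n) :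
    ContDiff ℝ ∞ (fun q => coeff q (Y q) j) := by
  rcases j with (i | i) | i
  · change ContDiff ℝ ∞ (fun q => (Y q).1 i)
    fun_prop
  · change ContDiff ℝ ∞ (fun q => (Y q).2.1 i)
    fun_prop
  · change ContDiff ℝ ∞
      (fun q => (Y q).2.2 - ∑ i, (q.2.1 i * (Y q).1 i - q.1 i * (Y q).2.1 i))
    fun_prop

theorem isPseudohermitian_nabla {n : ℕ} :
    IsPseudohermitian (fun (X Y : Point n → Point n) q => nabla Y q (X q)) where
  metric X Y W hX hY hW q := by
    have hy := fun j => ((contDiff_coeff hY j).differentiable (by simp)) q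
    have hw := fun j => ((contDiff_coeff hW j).differentiable (by simp)) q
    simp only [PiLp.inner_apply, RCLike.inner_apply, conj_trivial, coeff_nabla]
    rw [fderiv_fun_sum (fun j _ => (hw j).fun_mul (hy j))]
    simp only [fderiv_fun_mul (hw _) (hy _), sum_apply,
      add_apply, smul_apply, smul_eq_mul,
      ← Finset.sum_add_distrib]
    refine Finset.sum_congr rfl fun j _ => ?_
    ring
  torsion X Y hX hY q := by
    have hx := (hX.differentiable (by simp)) q
    have hy := (hY.differentiable (by simp)) q
    have key : ∀ (V : Point n → Point n), DifferentiableAt ℝ V q → ∀ w : Point n,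
        nabla V q w = fderiv ℝ V q w +
          (∑ i, (w.1 i * (V q).2.1 i - w.2.1 i * (V q).1 i)) • Z (Sum.inr ()) q := by
      intro V hV w
      let P1 : Fin n → Point n →L[ℝ] ℝ := fun i =>
        (ContinuousLinearMap.proj (R := ℝ) (φ := fun _ : Fin n => ℝ) i).comp
          (ContinuousLinearMap.fst ℝ (Fin n → ℝ) ((Fin n → ℝ) × ℝ))
      let P2 : Fin n → Point n →L[ℝ] ℝ := fun i =>
        (ContinuousLinearMap.proj (R := ℝ) (φ := fun _ : Fin n => ℝ) i).comp
          ((ContinuousLinearMap.fst ℝ (Fin n → ℝ) ℝ).comp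
            (ContinuousLinearMap.snd ℝ (Fin n → ℝ) ((Fin n → ℝ) × ℝ)))
      let P3 : Point n →L[ℝ] ℝ := (ContinuousLinearMap.snd ℝ (Fin n → ℝ) ℝ).comp
        (ContinuousLinearMap.snd ℝ (Fin n → ℝ) ((Fin n → ℝ) × ℝ))
      have h1 : ∀ i, HasFDerivAt (fun q' => (V q').1 i) ((P1 i).comp (fderiv ℝ V q)) q :=
        fun i => (P1 i).hasFDerivAt.comp q hV.hasFDerivAt
      have h2 : ∀ i, HasFDerivAt (fun q' => (V q').2.1 i) ((P2 i).comp (fderiv ℝ V q)) q :=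
        fun i => (P2 i).hasFDerivAt.comp q hV.hasFDerivAt
      have h3 : HasFDerivAt (fun q' => (V q').2.2) (P3.comp (fderiv ℝ V q)) q :=
        P3.hasFDerivAt.comp q hV.hasFDerivAt
      have p1 : ∀ i, HasFDerivAt (fun q' : Point n => q'.1 i) (P1 i) q :=
        fun i => (P1 i).hasFDerivAt
      have p2 : ∀ i, HasFDerivAt (fun q' : Point n => q'.2.1 i) (P2 i) q :=
        fun i => (P2 i).hasFDerivAt
      have h4 := h3.fun_sub (HasFDerivAt.fun_sum (u := Finset.univ)
        fun i _ => ((p2 i).fun_mul (h1 i)).fun_sub ((p1 i).fun_mul (h2 i)))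
      rw [← sum_coeff_smul_Z q (nabla V q w),
        ← sum_coeff_smul_Z q (fderiv ℝ V q w + _)]
      refine Finset.sum_congr rfl fun j _ => ?_
      congr 1
      rw [coeff_nabla, map_add, map_smul, coeff_Z]
      rcases j with (i | i) | i
      · change fderiv ℝ (fun q' => (V q').1 i) q w = _
        rw [(h1 i).fderiv]
        simp [coeff, P1]
      · change fderiv ℝ (fun q' => (V q').2.1 i) q w = _
        rw [(h2 i).fderiv]
        simp [coeff, P2]
      · change fderiv ℝ
          (fun q' => (V q').2.2 - ∑ i, (q'.2.1 i * (V q').1 i - q'.1 i * (V q').2.1 i)) q w = _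
        rw [h4.fderiv]
        simp [coeff, P1, P2, P3, Finset.sum_sub_distrib, Finset.sum_add_distrib, mul_comm]
        ring
    rw [key X hx, key Y hy, VectorField.lieBracket]
    have h5 : inner ℝ (J (coeff q (X q))) (coeff q (Y q)) =
        ∑ i, ((X q).1 i * (Y q).2.1 i - (X q).2.1 i * (Y q).1 i) := by
      simp [PiLp.inner_apply, J, coeff, Finset.sum_sub_distrib, mul_comm]
      ring
    have h6 : ∑ i, ((Y q).1 i * (X q).2.1 i - (Y q).2.1 i * (X q).1 i) =
        -∑ i, ((X q).1 i * (Y q).2.1 i - (X q).2.1 i * (Y q).1 i) := by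
      rw [← Finset.sum_neg_distrib]
      exact Finset.sum_congr rfl fun i _ => by ring
    rw [h5, h6]
    module

theorem isPseudohermitian_iff {n : ℕ}
    (D : (Point n → Point n) → (Point n → Point n) → Point n → Point n) :
    IsPseudohermitian D ↔ ∀ X Y : Point n → Point n, ContDiff ℝ ∞ X → ContDiff ℝ ∞ Y → ∀ q,
      D X Y q = nabla Y q (X q) := by
  constructor
  · intro hD X Y hX hY q
    have hN := isPseudohermitian_nabla (n := n)
    set S : (Point n → Point n) → (Point n → Point n) → (Point n → Point n) → ℝ :=
      fun X Y W => inner ℝ (coeff q (D X Y q) - coeff q (nabla Y q (X q))) (coeff q (W q)) with hS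
    have skew : ∀ X Y W, ContDiff ℝ ∞ X → ContDiff ℝ ∞ Y → ContDiff ℝ ∞ W →
        S X Y W = -S X W Y := by
      intro X Y W hX hY hW
      have h1 := hD.metric X Y W hX hY hW q
      have h2 := hN.metric X Y W hX hY hW q
      simp only [hS, inner_sub_left]
      rw [real_inner_comm (coeff q (D X W q)) (coeff q (Y q))] at h1
      rw [real_inner_comm (coeff q (nabla W q (X q))) (coeff q (Y q))] at h2
      linarith
    have symm : ∀ X Y W, ContDiff ℝ ∞ X → ContDiff ℝ ∞ Y → S X Y W = S Y X W := by
      intro X Y W hX hY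
      have h1 := hD.torsion X Y hX hY q
      have h2 := hN.torsion X Y hX hY q
      have h3 : D X Y q - nabla Y q (X q) = D Y X q - nabla X q (Y q) := by
        have h4 := h1.trans h2.symm
        have h5 : D X Y q - D Y X q = nabla Y q (X q) - nabla X q (Y q) := by
          simpa using h4
        linear_combination (exp := 1) h5
      simp only [hS, ← map_sub, h3]
    have zero : ∀ W, ContDiff ℝ ∞ W → S X Y W = 0 := by
      intro W hW
      have e1 := skew X Y W hX hY hW
      have e2 := symm X W Y hX hW
      have e3 := skew W X Y hW hX hY
      have e4 := symm W Y X hW hY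
      have e5 := skew Y W X hY hW hX
      have e6 := symm Y X W hY hX
      linarith
    have hz : coeff q (D X Y q) - coeff q (nabla Y q (X q)) = 0 := by
      have hc : ContDiff ℝ ∞ (fun q' : Point n =>
          ∑ j, (coeff q (D X Y q) - coeff q (nabla Y q (X q))) j • Z j q') := by
        refine ContDiff.sum fun j _ => ContDiff.const_smul _ ?_
        rcases j with (i | i) | i <;> simp only [Z] <;> fun_prop
      have := zero _ hc
      simp only [hS, map_sum, map_smul, coeff_Z] at this
      rw [← inner_self_eq_zero (𝕜 := ℝ)]
      convert this using 2
      ext k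
      simp only [WithLp.ofLp_sum, Finset.sum_apply, PiLp.smul_apply, PiLp.single_apply,
        smul_eq_mul, mul_ite, mul_one, mul_zero]
      rw [Finset.sum_ite_eq]
      simp
    rw [← map_sub] at hz
    have := sum_coeff_smul_Z q (D X Y q - nabla Y q (X q))
    rw [hz] at this
    simpa [sub_eq_zero, eq_comm] using this
  · intro h
    have hN := isPseudohermitian_nabla (n := n)
    exact
      { metric := fun X Y W hX hY hW q => by
          rw [h X Y hX hY q, h X W hX hW q]
          exact hN.metric X Y W hX hY hW q
        torsion := fun X Y hX hY q => by
          rw [h X Y hX hY q, h Y X hY hX q]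
          exact hN.torsion X Y hX hY q }

/-! ## Immersed hypersurfaces -/

section Hypersurface

variable {n : ℕ} {M : Type*} [TopologicalSpace M] [ChartedSpace (EuclideanSpace ℝ (Fin (2 * n))) M]

/-- The tangent space `T_p S` of the hypersurface at `p`; it is the tangent space of the
`2n`-dimensional manifold `M` that is immersed in `ℍⁿ`. -/
abbrev TS (n : ℕ) {M : Type*} [TopologicalSpace M]
    [ChartedSpace (EuclideanSpace ℝ (Fin (2 * n))) M] (p : M) : Type :=
  TangentSpace (𝓡 (2 * n)) p

/-- The derivative `X f` at `p` of a function `f` on the hypersurface, for `X ∈ T_p S`. -/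
def dir {F : Type*} [NormedAddCommGroup F] [NormedSpace ℝ F] (f : M → F) (p : M) (X : TS n p) : F :=
  mfderiv (𝓡 (2 * n)) 𝓘(ℝ, F) f p X

/-- `φ : M → ℍⁿ` is a smooth immersion of the `2n`-dimensional manifold `M`, that is, a smooth,
immersed hypersurface. -/
structure IsImmersedHypersurface (φ : M → Point n) : Prop where
  smooth : ContMDiff (𝓡 (2 * n)) 𝓘(ℝ, Point n) ∞ φ
  injective : ∀ p, Function.Injective (mfderiv (𝓡 (2 * n)) 𝓘(ℝ, Point n) φ p)

/-- A tangent vector `X ∈ T_p S`, regarded through `dφ` as a tangent vector of `ℍⁿ`. -/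
def push (φ : M → Point n) (p : M) : TS n p →ₗ[ℝ] Vec n where
  toFun X := coeff (φ p) (dir φ p X)
  map_add' X Y := by
    have h1 : dir φ p (X + Y) = dir φ p X + dir φ p Y :=
      map_add (mfderiv (𝓡 (2 * n)) 𝓘(ℝ, Point n) φ p) X Y
    rw [h1, map_add]
  map_smul' c X := by
    have h1 : dir φ p (c • X) = c • dir φ p X :=
      map_smul (mfderiv (𝓡 (2 * n)) 𝓘(ℝ, Point n) φ p) c X
    rw [h1, map_smul, RingHom.id_apply]

/-- The tangent vector `X ∈ T_p S` with `dφ X = v` (for `v` in the image of `dφ` at `p`). -/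
def lift (φ : M → Point n) (p : M) (v : Vec n) : TS n p := Function.invFun (push φ p) v

/-- `p` is characteristic when `𝓗_p = T_p S`. -/
def IsCharacteristic (φ : M → Point n) (p : M) : Prop :=
  LinearMap.range (push φ p) = horizontal n

/-- The horizontal tangent space `𝓗 T_p S = 𝓗_p ∩ T_p S`. -/
def HTS (φ : M → Point n) (p : M) : Submodule ℝ (TS n p) := (horizontal n).comap (push φ p)

/-- The derivative `∇_X V` of a vector field `V` along the hypersurface (a section of `Tℍⁿ`), for
`X ∈ T_p S`. As the left-invariant frame is parallel, the coefficients are differentiated; see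
`cov_restrict` for the restriction of a vector field of `ℍⁿ`. -/
def cov (V : M → Vec n) (p : M) (X : TS n p) : Vec n := dir V p X

theorem cov_restrict {φ : M → Point n} {p : M}
    (hφ : MDifferentiableAt (𝓡 (2 * n)) 𝓘(ℝ, Point n) φ p) {Y : Point n → Point n}
    (hY : ContDiff ℝ ∞ Y) (X : TS n p) :
    cov (fun q => coeff (φ q) (Y (φ q))) p X = coeff (φ p) (nabla Y (φ p) (dir φ p X)) := by
  have hd : DifferentiableAt ℝ (fun q => coeff q (Y q)) (φ p) := by
    rw [differentiableAt_euclidean]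
    exact fun j => ((contDiff_coeff hY j).differentiable (by simp)) _
  have h1 := mfderiv_comp (I := 𝓡 (2 * n)) (I' := 𝓘(ℝ, Point n)) (I'' := 𝓘(ℝ, Vec n)) p
    hd.mdifferentiableAt hφ
  have h2 : cov (fun q => coeff (φ q) (Y (φ q))) p X =
      fderiv ℝ (fun q => coeff q (Y q)) (φ p) (dir φ p X) := by
    have h3 := congrArg (fun L => L X) h1
    rw [mfderiv_eq_fderiv] at h3
    exact h3
  rw [h2]
  ext j
  rw [coeff_nabla]
  have h4 := (EuclideanSpace.proj j : Vec n →L[ℝ] ℝ).hasFDerivAt.comp (φ p)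
    hd.hasFDerivAt
  exact (congrArg (fun L => L (dir φ p X)) h4.fderiv).symm

/-! ### Normals, the fundamental function and the second fundamental forms

All of this is defined from a local choice `N` of the Riemannian unit normal. -/

/-- `N` is a smooth Riemannian unit normal on `U`. -/
structure IsUnitNormal (φ : M → Point n) (U : Set M) (N : M → Vec n) : Prop where
  smooth : ContMDiffOn (𝓡 (2 * n)) 𝓘(ℝ, Vec n) ∞ N U
  unit : ∀ p ∈ U, ‖N p‖ = 1
  normal : ∀ p ∈ U, ∀ X : TS n p, inner ℝ (N p) (push φ p X) = 0

/-- The projection `N^ℍ = N - ⟨N, T⟩ T` of `N` onto `𝓗`. -/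
def horNormal (N : M → Vec n) (p : M) : Vec n := N p - inner ℝ (N p) T • T

/-- The horizontal unit normal `ν = N^ℍ / |N^ℍ|`. -/
def nu (N : M → Vec n) (p : M) : Vec n := ‖horNormal N p‖⁻¹ • horNormal N p

/-- The fundamental function `α = ⟨N, T⟩ / |N^ℍ|`. -/
def alpha (N : M → Vec n) (p : M) : ℝ := inner ℝ (N p) T / ‖horNormal N p‖

/-- `J(ν)`, as an element of `𝓗 T_p S`. -/
def Jnu (φ : M → Point n) (N : M → Vec n) (p : M) : TS n p := lift φ p (J (nu N p))

/-- The tangent pseudohermitian connection `∇^S_X Y = ∇_X Y - ⟨∇_X Y, ν⟩ ν`, for `X ∈ T_p S` and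
a horizontal tangent vector field `Y`. -/
def nablaS (φ : M → Point n) (N : M → Vec n) (p : M) (X : TS n p) (Y : ∀ q : M, TS n q) : TS n p :=
  let D := cov (fun q => push φ q (Y q)) p X
  lift φ p (D - inner ℝ D (nu N p) • nu N p)

/-- `J'`, which is `J` on `𝓗' TS = 𝓗 TS ∩ J(𝓗 TS)` and maps `J(ν)` to zero. It is applied to
`v ∈ 𝓗 TS`, whose `𝓗' TS`-component is `v - ⟨v, J(ν)⟩ J(ν)`. -/
def J' (N : M → Vec n) (p : M) (v : Vec n) : Vec n :=
  J (v - inner ℝ v (J (nu N p)) • J (nu N p))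

/-- The horizontal shape operator `A(X) = ∇_X ν`. -/
def shape (N : M → Vec n) (p : M) (X : TS n p) : Vec n := cov (nu N) p X

/-- The symmetric horizontal shape operator `Ã(X) = ∇_X ν + α J'(X)`. -/
def shapeSymm (φ : M → Point n) (N : M → Vec n) (p : M) (X : TS n p) : Vec n :=
  shape N p X + alpha N p • J' N p (push φ p X)

/-- The horizontal second fundamental form `h(X, Y) = ⟨A(X), Y⟩`. -/
def h (φ : M → Point n) (N : M → Vec n) (p : M) (X Y : TS n p) : ℝ :=
  inner ℝ (shape N p X) (push φ p Y)

/-- The symmetric horizontal second fundamental form `h̃(X, Y) = ⟨Ã(X), Y⟩`. -/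
def hSymm (φ : M → Point n) (N : M → Vec n) (p : M) (X Y : TS n p) : ℝ :=
  inner ℝ (shapeSymm φ N p X) (push φ p Y)

/-- `ℓ = h(J(ν), J(ν))`. -/
def ell (φ : M → Point n) (N : M → Vec n) (p : M) : ℝ := h φ N p (Jnu φ N p) (Jnu φ N p)

/-- The covariant derivative of a horizontal `(2,0)`-tensor field `B`:
`(∇^S_X B)(Y, W) = X (B(Y, W)) - B(∇^S_X Y, W) - B(Y, ∇^S_X W)`. -/
def nablaTensor (φ : M → Point n) (N : M → Vec n) (B : ∀ q : M, TS n q → TS n q → ℝ) (p : M)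
    (X : TS n p) (Y W : ∀ q : M, TS n q) : ℝ :=
  dir (fun q => B q (Y q) (W q)) p X - B p (nablaS φ N p X Y) (W p) - B p (Y p) (nablaS φ N p X W)

/-! ### Local frames, traces and norms -/

/-- `E_1, …, E_{2n-1}` is a smooth orthonormal frame of `𝓗 TS` on `U`. -/
structure IsOrthonormalFrame [IsManifold (𝓡 (2 * n)) ∞ M] (φ : M → Point n) (U : Set M)
    (E : Fin (2 * n - 1) → ∀ q : M, TS n q) : Prop where
  smooth : ∀ i, ContMDiffOn (𝓡 (2 * n)) (𝓡 (2 * n)).tangent ∞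
    (fun q => (⟨q, E i q⟩ : TangentBundle (𝓡 (2 * n)) M)) U
  horizontal : ∀ p ∈ U, ∀ i, E i p ∈ HTS φ p
  orthonormal : ∀ p ∈ U, Orthonormal ℝ fun i => push φ p (E i p)

/-- `U` is an open part of the non-characteristic part of the hypersurface, on which `N` is a
Riemannian unit normal and `E` is an orthonormal frame of `𝓗 TS`. Each non-characteristic point has
such neighbourhoods. -/
structure IsLocalFrame [IsManifold (𝓡 (2 * n)) ∞ M] (φ : M → Point n) (U : Set M)
    (N : M → Vec n) (E : Fin (2 * n - 1) → ∀ q : M, TS n q) : Prop where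
  isOpen : IsOpen U
  nonchar : ∀ p ∈ U, ¬ IsCharacteristic φ p
  normal : IsUnitNormal φ U N
  frame : IsOrthonormalFrame φ U E

variable (φ : M → Point n) (N : M → Vec n) (E : Fin (2 * n - 1) → ∀ q : M, TS n q)

/-- The horizontal mean curvature `H = tr h`. -/
def meanCurvature (p : M) : ℝ := ∑ i, h φ N p (E i p) (E i p)

/-- `|h̃|²`. -/
def normSqHSymm (p : M) : ℝ := ∑ i, ∑ j, hSymm φ N p (E i p) (E j p) ^ 2

/-- `|∇^{𝓗,S} h̃|²`. -/
def normSqNablaHSymm (p : M) : ℝ :=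
  ∑ i, ∑ j, ∑ k, nablaTensor φ N (hSymm φ N) p (E i p) (E j) (E k) ^ 2

/-- The horizontal tangential gradient `∇^{𝓗,S} f = ∑ (E_j f) E_j`. -/
def gradHS (f : M → ℝ) (p : M) : TS n p := ∑ j, dir f p (E j p) • E j p

/-- `|∇^{𝓗,S} f|²`. -/
def normSqGradHS (f : M → ℝ) (p : M) : ℝ := ‖push φ p (gradHS E f p)‖ ^ 2

variable [IsManifold (𝓡 (2 * n)) ∞ M]

/-- The hypersurface is minimal: `H` vanishes on the non-characteristic part. -/
def IsMinimal : Prop :=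
  ∀ U N E, IsLocalFrame φ U N E → ∀ p ∈ U, meanCurvature φ N E p = 0

/-- Property `(P1)`: `∇_{J(ν)} ν - ℓ J(ν)` vanishes on the non-characteristic part. -/
def P1 : Prop :=
  ∀ U N E, IsLocalFrame φ U N E → ∀ p ∈ U,
    cov (nu N) p (Jnu φ N p) - ell φ N p • J (nu N p) = 0

/-- Property `(P2)`: `∇^{𝓗,S} α = ⟨∇ α, J(ν)⟩ J(ν)` on the non-characteristic part, where
`⟨∇ α, J(ν)⟩` is the derivative of `α` in the tangent direction `J(ν)`. -/
def P2 : Prop :=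
  ∀ U N E, IsLocalFrame φ U N E → ∀ p ∈ U,
    gradHS E (alpha N) p = dir (alpha N) p (Jnu φ N p) • Jnu φ N p

end Hypersurface

end Heisenberg
end

/-! Fix an orthonormal frame of `𝓗 TS`, of rank `m = 2n - 1`. Write `B`, `C`, `z`, `ω` for the
components of `h̃`, of `∇^S h̃`, of `J(ν)` and of the compression of `J` to `𝓗 TS`, and put `β =
|B|²`. Since the connection is metric, the derivative of `|h̃|²` along `E_i` is `2⟨B, C_i⟩`, so the
first inequality is Cauchy–Schwarz.

For a totally symmetric trace-free `C` and a trace-free symmetric `B`, pairing `C` with the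
symmetric trace-free part of `v ⊗ B`, `v_i = ⟨B, C_i⟩`, gains the factor `1 + 2/m`
(`kato_of_symm_traceless`). Minimality makes `B` and every `C_i` trace-free, and `C` is symmetric in
its last two slots, but the Codazzi equation leaves a defect in the first two. By (P2) the
differential of `α` is a multiple of `z`, and then every term of the defect carries a factor `z`.
Removing from `C` its `z`-components therefore leaves a totally symmetric trace-free `C'`, to which
the refined inequality applies.

The removed part is controlled through (P1), which makes `z` an eigenvector of `B` with eigenvalue
`ℓ`. Differentiating `B z = ℓ z` expresses the contraction `P` of `C` with `z` in the last slot.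
Codazzi compares `P` with the contraction `Q` in the first slot, and the vanishing trace of `Q` then
forces `dℓ = -(m + 1) α ℓ z`. Hence `⟨B, Q⟩ = -α (m ℓ² + 2β)`, and the removed norm is bounded below
in terms of `α`, `ℓ`, `β`. What remains is `scalar_kato_bound`, which rests on `m ℓ² ≤ (m - 1) β`.
All this is `improved_kato_pointwise`.

The geometric input is that the left-invariant frame is parallel: the connection is flat and only
its torsion is seen. Differentiating `⟨ν + α T, ·⟩ = 0` on `TS` gives `structure_equation`, hence
the symmetry of `h̃` and the derivative of `ν` in the direction `α ν - T`. Commuting second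
derivatives of `ν` gives `codazzi`. -/

namespace Heisenberg

/-! ### Refined Kato inequality for symmetric trace-free tensors. -/

section TensorAlgebra

variable {ι : Type*} [Fintype ι]

/-- The Euclidean inner product of two matrices. -/
def ip2 (A B : ι → ι → ℝ) : ℝ := ∑ i, ∑ j, A i j * B i j

/-- The Euclidean inner product of two three-index arrays. -/
def ip3 (A B : ι → ι → ι → ℝ) : ℝ := ∑ i, ip2 (A i) (B i)

theorem ip2_add_left (A B C : ι → ι → ℝ) : ip2 (A + B) C = ip2 A C + ip2 B C := by
  simp [ip2, add_mul, Finset.sum_add_distrib]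

theorem ip2_smul_left (c : ℝ) (A C : ι → ι → ℝ) : ip2 (c • A) C = c * ip2 A C := by
  simp [ip2, Finset.mul_sum, mul_assoc]

theorem ip2_comm (A C : ι → ι → ℝ) : ip2 A C = ip2 C A := by
  simp [ip2, mul_comm]

theorem ip2_sub_left (A B C : ι → ι → ℝ) : ip2 (A - B) C = ip2 A C - ip2 B C := by
  simp [ip2, sub_mul, Finset.sum_sub_distrib]

theorem ip2_add_right (A B C : ι → ι → ℝ) : ip2 C (A + B) = ip2 C A + ip2 C B := by
  simp [ip2, mul_add, Finset.sum_add_distrib]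

theorem ip2_sub_right (A B C : ι → ι → ℝ) : ip2 C (A - B) = ip2 C A - ip2 C B := by
  simp [ip2, mul_sub, Finset.sum_sub_distrib]

theorem ip2_smul_right (c : ℝ) (A C : ι → ι → ℝ) : ip2 C (c • A) = c * ip2 C A := by
  rw [ip2_comm, ip2_smul_left, ip2_comm]

theorem ip2_self_nonneg (A : ι → ι → ℝ) : 0 ≤ ip2 A A :=
  Finset.sum_nonneg fun _ _ => Finset.sum_nonneg fun _ _ => mul_self_nonneg _

theorem ip2_transpose (A B : ι → ι → ℝ) :
    ip2 (fun i j => A j i) (fun i j => B j i) = ip2 A B := Finset.sum_comm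

/-- The source of all cancellations of connection terms, whose coefficients are antisymmetric in the
last two indices. -/
theorem ip2_eq_zero_of_symm_antisymm {A B : ι → ι → ℝ} (hA : ∀ i j, A i j = A j i)
    (hB : ∀ i j, B i j = -B j i) : ip2 A B = 0 := by
  have h : ip2 A B = -ip2 A B := by
    conv_lhs => rw [← ip2_transpose]
    simp only [ip2, ← Finset.sum_neg_distrib]
    refine Finset.sum_congr rfl fun i _ => Finset.sum_congr rfl fun j _ => ?_
    rw [hA j i, hB j i]
    ring
  linarith

theorem ip3_smul_left (c : ℝ) (A C : ι → ι → ι → ℝ) : ip3 (c • A) C = c * ip3 A C := by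
  simp [ip3, ip2_smul_left, Finset.mul_sum]

theorem ip3_comm (A C : ι → ι → ι → ℝ) : ip3 A C = ip3 C A := by
  simp [ip3, ip2_comm]

theorem ip3_add_right (A B C : ι → ι → ι → ℝ) : ip3 C (A + B) = ip3 C A + ip3 C B := by
  simp [ip3, ip2_add_right, Finset.sum_add_distrib]

theorem ip3_sub_right (A B C : ι → ι → ι → ℝ) : ip3 C (A - B) = ip3 C A - ip3 C B := by
  simp [ip3, ip2_sub_right, Finset.sum_sub_distrib]

theorem ip3_smul_right (c : ℝ) (A C : ι → ι → ι → ℝ) : ip3 C (c • A) = c * ip3 C A := by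
  rw [ip3_comm, ip3_smul_left, ip3_comm]

theorem ip3_self_nonneg (A : ι → ι → ι → ℝ) : 0 ≤ ip3 A A :=
  Finset.sum_nonneg fun _ _ => ip2_self_nonneg _

theorem ip3_swap_left (A B : ι → ι → ι → ℝ) :
    ip3 (fun i j k => A j i k) (fun i j k => B j i k) = ip3 A B := Finset.sum_comm

theorem ip3_swap_right (A B : ι → ι → ι → ℝ) :
    ip3 (fun i j k => A i k j) (fun i j k => B i k j) = ip3 A B :=
  Finset.sum_congr rfl fun _ _ => Finset.sum_comm

theorem ip2_sq_le (A B : ι → ι → ℝ) : ip2 A B ^ 2 ≤ ip2 A A * ip2 B B := by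
  have h := Finset.sum_mul_sq_le_sq_mul_sq Finset.univ (fun p : ι × ι => A p.1 p.2)
    (fun p : ι × ι => B p.1 p.2)
  simpa [ip2, Fintype.sum_prod_type, sq] using h

theorem ip3_sq_le (A B : ι → ι → ι → ℝ) : ip3 A B ^ 2 ≤ ip3 A A * ip3 B B := by
  have h := Finset.sum_mul_sq_le_sq_mul_sq Finset.univ (fun p : ι × ι × ι => A p.1 p.2.1 p.2.2)
    (fun p : ι × ι × ι => B p.1 p.2.1 p.2.2)
  simpa [ip3, ip2, Fintype.sum_prod_type, sq] using h

/-- The rank-one matrix `v ⊗ w`. -/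
def tens (v w : ι → ℝ) : ι → ι → ℝ := fun i j => v i * w j

theorem ip2_tens_right (A : ι → ι → ℝ) (v w : ι → ℝ) :
    ip2 A (tens v w) = ∑ i, v i * ∑ j, A i j * w j := by
  simp only [ip2, tens, Finset.mul_sum]
  exact Finset.sum_congr rfl fun i _ => Finset.sum_congr rfl fun j _ => by ring

theorem ip2_tens_tens (v w v' w' : ι → ℝ) :
    ip2 (tens v w) (tens v' w') = (∑ i, v i * v' i) * ∑ i, w i * w' i := by
  simp only [ip2, tens, Finset.sum_mul_sum]
  exact Finset.sum_congr rfl fun i _ => Finset.sum_congr rfl fun j _ => by ring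

variable [DecidableEq ι]

/-- The identity matrix. -/
def idm : ι → ι → ℝ := fun i j => if i = j then 1 else 0

theorem ip2_idm (A : ι → ι → ℝ) : ip2 A idm = ∑ i, A i i := by
  simp [ip2, idm]

theorem ip2_idm_idm : ip2 (idm : ι → ι → ℝ) idm = Fintype.card ι := by
  simp [ip2_idm, idm]

/-- For a trace-free symmetric `A`, `|A v|² ≤ (1 - 1/m) |A|² |v|²`. -/
theorem card_mul_sq_mulVec_le {A : ι → ι → ℝ} {v w : ι → ℝ} (hm : 2 ≤ Fintype.card ι)
    (hA : ∀ i j, A i j = A j i) (htr : ∑ i, A i i = 0) (hw : ∀ i, ∑ j, A i j * v j = w i) :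
    Fintype.card ι * ∑ i, w i * w i ≤
      (Fintype.card ι - 1) * (ip2 A A * ∑ i, v i * v i) := by
  have hm' : (2 : ℝ) ≤ Fintype.card ι := by exact_mod_cast hm
  set m : ℝ := (Fintype.card ι : ℝ) with hmdef
  set W := ∑ i, w i * w i with hW
  set V := ∑ i, v i * v i with hV
  set D := ∑ i, w i * v i with hD
  have hD' : ∑ i, v i * w i = D := by simp [hD, mul_comm]
  -- The test matrix is the trace-free part of `w ⊗ v + v ⊗ w`, whose trace is `2D`. Removing the
  -- trace costs nothing against `A` and lowers the norm, which produces the factor `1 - 1/m`.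
  have hAG : ip2 A (tens w v + tens v w - (2 * D / m) • idm) = 2 * W := by
    have h2 : ip2 A (tens v w) = W := by
      rw [← ip2_transpose]
      have : (fun i j => tens v w j i) = tens w v := by ext i j; simp [tens, mul_comm]
      rw [this, ip2_tens_right]
      simp only [hW]
      refine Finset.sum_congr rfl fun i _ => ?_
      simp only [hA _ i, hw]
    rw [ip2_sub_right, ip2_add_right, ip2_smul_right, ip2_idm, htr, h2, ip2_tens_right]
    simp only [hw, ← hW]
    ring
  have hGG : ip2 (tens w v + tens v w - (2 * D / m) • idm)
      (tens w v + tens v w - (2 * D / m) • idm) = 2 * W * V + 2 * D ^ 2 - 4 * D ^ 2 / m := by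
    have t1 : ∀ x y : ι → ℝ, ip2 (tens x y) idm = ∑ i, x i * y i := fun x y => ip2_idm _
    have t2 : ∀ x y : ι → ℝ, ip2 idm (tens x y) = ∑ i, x i * y i := fun x y => by
      rw [ip2_comm, t1]
    simp only [ip2_sub_right, ip2_add_right, ip2_smul_right, ip2_sub_left, ip2_add_left,
      ip2_smul_left, ip2_tens_tens, ip2_idm_idm, t1, t2, ← hmdef, ← hW, ← hV, ← hD, hD']
    field_simp
    ring
  have hcs := ip2_sq_le A (tens w v + tens v w - (2 * D / m) • idm)
  rw [hAG, hGG] at hcs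
  have hDW : D ^ 2 ≤ W * V := by
    have := Finset.sum_mul_sq_le_sq_mul_sq Finset.univ w v
    simpa [hW, hV, hD, sq] using this
  have hβ := ip2_self_nonneg A
  have hW0 : 0 ≤ W := Finset.sum_nonneg fun _ _ => mul_self_nonneg _
  have hV0 : 0 ≤ V := Finset.sum_nonneg fun _ _ => mul_self_nonneg _
  -- Cauchy–Schwarz bounds `W²`, so one factor `W` has to be cancelled.
  rcases hW0.eq_or_lt with h0 | h0
  · rw [← h0, mul_zero]
    have : 0 ≤ m - 1 := by linarith
    positivity
  · have h1 : 2 * W * V + 2 * D ^ 2 - 4 * D ^ 2 / m ≤ 4 * (W * V) * ((m - 1) / m) := by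
      have : 4 * (W * V) * ((m - 1) / m) - (2 * W * V + 2 * D ^ 2 - 4 * D ^ 2 / m) =
          2 * (W * V - D ^ 2) * ((m - 2) / m) := by
        field_simp
        ring
      have h2 : 0 ≤ 2 * (W * V - D ^ 2) * ((m - 2) / m) :=
        mul_nonneg (by linarith) (div_nonneg (by linarith) (by linarith))
      linarith
    have h3 := hcs.trans (mul_le_mul_of_nonneg_left h1 hβ)
    have h4 : W * (m * W) ≤ W * ((m - 1) * (ip2 A A * V)) := by
      have h5 : m * (ip2 A A * (4 * (W * V) * ((m - 1) / m))) =
          4 * (W * ((m - 1) * (ip2 A A * V))) := by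
        field_simp
      have h6 := mul_le_mul_of_nonneg_left h3 (by linarith : (0 : ℝ) ≤ m)
      rw [h5] at h6
      nlinarith
    exact le_of_mul_le_mul_left h4 h0

/-- The symmetrization of `3 v ⊗ A`, corrected by a multiple `c` of the symmetrization of
`3 w ⊗ 1`. -/
def symTens (v : ι → ℝ) (A : ι → ι → ℝ) (c : ℝ) (w : ι → ℝ) : ι → ι → ι → ℝ := fun i j k =>
  v i * A j k + v j * A i k + v k * A i j - c * (w i * idm j k + w j * idm i k + w k * idm i j)

theorem idm_symm {ι : Type*} [DecidableEq ι] (i j : ι) : (idm i j : ℝ) = idm j i := by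
  simp [idm, eq_comm]

/-- A totally symmetric `X` pairs equally with the three permuted copies of `v ⊗ A`, and a
trace-free one does not see the `idm` terms. Used for `X = C` and for `X` the symmetrized tensor
itself, which yields its norm. -/
theorem ip3_symTens {X : ι → ι → ι → ℝ} (v : ι → ℝ) (A : ι → ι → ℝ) (c : ℝ) (w : ι → ℝ)
    (hX1 : ∀ i j k, X i j k = X j i k) (hX2 : ∀ i j k, X i j k = X i k j)
    (hXtr : ∀ i, ∑ j, X i j j = 0) :
    ip3 X (symTens v A c w) = 3 * ∑ i, v i * ip2 A (X i) := by
  have first : ∀ (x : ι → ℝ) (B : ι → ι → ℝ),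
      ip3 X (fun i j k => x i * B j k) = ∑ i, x i * ip2 B (X i) := fun x B => by
    simp only [ip3, ip2, Finset.mul_sum]
    exact Finset.sum_congr rfl fun i _ => Finset.sum_congr rfl fun j _ =>
      Finset.sum_congr rfl fun k _ => by ring
  have second : ∀ (x : ι → ℝ) (B : ι → ι → ℝ),
      ip3 X (fun i j k => x j * B i k) = ∑ i, x i * ip2 B (X i) := fun x B => by
    rw [← first, ← ip3_swap_left]
    congr 1
    ext i j k
    exact hX1 j i k
  have third : ∀ (x : ι → ℝ) (B : ι → ι → ℝ),
      ip3 X (fun i j k => x k * B i j) = ∑ i, x i * ip2 B (X i) := fun x B => by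
    rw [← second, ← ip3_swap_right]
    congr 1
    ext i j k
    exact hX2 i k j
  have trace : ∑ i, w i * ip2 idm (X i) = 0 := by
    simp only [ip2_comm idm, ip2_idm, hXtr, mul_zero, Finset.sum_const_zero]
  have split : symTens v A c w =
      ((fun i j k => v i * A j k) + (fun i j k => v j * A i k) + fun i j k => v k * A i j) -
      c • ((fun i j k => w i * idm j k) + (fun i j k => w j * idm i k) +
        fun i j k => w k * idm i j) := rfl
  rw [split]
  simp only [ip3_sub_right, ip3_add_right, ip3_smul_right, first, second, third, trace]
  ring

/-- The refined Kato inequality for a totally symmetric trace-free three-tensor `C`, contracted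
with a trace-free symmetric matrix `A`. -/
theorem kato_of_symm_traceless {A : ι → ι → ℝ} {C : ι → ι → ι → ℝ} (hm : 2 ≤ Fintype.card ι)
    (hA : ∀ i j, A i j = A j i) (htr : ∑ i, A i i = 0)
    (hC1 : ∀ i j k, C i j k = C j i k) (hC2 : ∀ i j k, C i j k = C i k j)
    (hCtr : ∀ i, ∑ j, C i j j = 0) :
    (1 + 2 / (Fintype.card ι : ℝ)) * ∑ i, ip2 A (C i) * ip2 A (C i) ≤ ip2 A A * ip3 C C := by
  have hm' : (2 : ℝ) ≤ Fintype.card ι := by exact_mod_cast hm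
  set v : ι → ℝ := fun i => ip2 A (C i) with hv
  set w : ι → ℝ := fun i => ∑ j, A i j * v j with hw
  have hWV := card_mul_sq_mulVec_le hm hA htr (v := v) (w := w) (fun i => rfl)
  set m : ℝ := (Fintype.card ι : ℝ) with hmdef
  set W := ∑ i, w i * w i with hW
  set V := ∑ i, v i * v i with hV
  set β := ip2 A A with hβ
  -- The trace of the symmetrization is `2w`, that of the correction is `c (m + 2) w`; this `c`
  -- makes the difference trace-free.
  set c : ℝ := 2 / (m + 2) with hc
  have hc' : c * (m + 2) = 2 := by
    rw [hc]
    field_simp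
  have hAw : ∑ i, v i * ∑ j, A i j * w j = W := by
    simp only [hW, Finset.mul_sum]
    rw [Finset.sum_comm]
    refine Finset.sum_congr rfl fun j _ => ?_
    conv_rhs => rw [hw]
    simp only [Finset.mul_sum]
    refine Finset.sum_congr rfl fun i _ => ?_
    rw [hA j i]
    ring
  have g1 : ∀ i j k, symTens v A c w i j k = symTens v A c w j i k := fun i j k => by
    simp only [symTens]
    rw [hA i j, idm_symm i j]
    ring
  have g2 : ∀ i j k, symTens v A c w i j k = symTens v A c w i k j := fun i j k => by
    simp only [symTens]
    rw [hA j k, idm_symm j k]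
    ring
  have gtr : ∀ i, ∑ j, symTens v A c w i j j = 0 := fun i => by
    have e1 : ∑ j, w j * idm i j = w i := by simp [idm]
    have e2 : ∑ j : ι, (idm j j : ℝ) = m := by simp [idm, hmdef]
    have e3 : ∑ j, v j * A i j = w i := by simp [hw, mul_comm]
    simp only [symTens, Finset.sum_sub_distrib, Finset.sum_add_distrib, ← Finset.mul_sum, htr,
      e1, e2, e3]
    linear_combination (-w i) * hc'
  have hGC := ip3_symTens v A c w hC1 hC2 hCtr
  have hGG := ip3_symTens v A c w g1 g2 gtr
  have hAG : ∀ i, ip2 A (symTens v A c w i) =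
      v i * β + 2 * (∑ j, A i j * w j) - c * (2 * ∑ j, A i j * w j) := fun i => by
    have split : symTens v A c w i = v i • A + tens v (A i) + tens (A i) v -
        c • (w i • idm + tens w (idm i) + tens (idm i) w) := by
      ext j k
      simp only [symTens, tens, Pi.sub_apply, Pi.add_apply, Pi.smul_apply, smul_eq_mul]
      ring
    have t1 : ip2 A (tens v (A i)) = ∑ j, A i j * w j := by
      rw [ip2_tens_right]
      simp only [hw, Finset.mul_sum]
      rw [Finset.sum_comm]
      refine Finset.sum_congr rfl fun j _ => Finset.sum_congr rfl fun k _ => ?_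
      rw [hA k j]
      ring
    have t2 : ∀ x y, ip2 A (tens x y) = ip2 A (tens y x) := fun x y => by
      rw [← ip2_transpose]
      congr 1
      · ext j k
        exact hA k j
      · ext j k
        exact mul_comm _ _
    have t3 : ip2 A (tens (idm i) w) = ∑ j, A i j * w j := by
      rw [ip2_tens_right]
      simp [idm]
    rw [split]
    simp only [ip2_sub_right, ip2_add_right, ip2_smul_right, t2 (A i) v, t2 w, t1, t3, ip2_idm,
      htr]
    ring
  have hsum : ∑ i, v i * ip2 A (symTens v A c w i) = V * β + (2 - 2 * c) * W := by
    have : ∀ i, v i * ip2 A (symTens v A c w i) =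
        v i * v i * β + (2 - 2 * c) * (v i * ∑ j, A i j * w j) := fun i => by
      rw [hAG]
      ring
    simp only [this, Finset.sum_add_distrib, ← Finset.mul_sum, ← Finset.sum_mul, hAw, ← hV]
  rw [hsum] at hGG
  have hcs := ip3_sq_le C (symTens v A c w)
  rw [hGC, hGG] at hcs
  have hV' : ∑ i, v i * ip2 A (C i) = V := rfl
  rw [hV'] at hcs
  have hC0 := ip3_self_nonneg C
  have hβ0 := ip2_self_nonneg A
  have hV0 : 0 ≤ V := Finset.sum_nonneg fun _ _ => mul_self_nonneg _
  rcases hV0.eq_or_lt with h0 | h0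
  · rw [← h0, mul_zero]
    positivity
  -- Here `2 - 2c = 2m/(m + 2)`, and `m W ≤ (m - 1) β V` turns the squared norm of the test tensor
  -- into at most `9 β V / (1 + 2/m)`. Against the pairing `3V` this is exactly the Kato constant.
  · have h1 : m * (V * β + (2 - 2 * c) * W) ≤ V * β * (3 * m / (1 + 2 / m)) := by
      have e : V * β * (3 * m / (1 + 2 / m)) - m * (V * β + (2 - 2 * c) * W) =
          (2 * m / (m + 2)) * ((m - 1) * (β * V) - m * W) := by
        rw [hc]
        field_simp
        ring
      have : 0 ≤ (2 * m / (m + 2)) * ((m - 1) * (β * V) - m * W) :=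
        mul_nonneg (by positivity) (by linarith)
      linarith
    have h2 : 3 * m * (3 * V ^ 2) ≤ 3 * ip3 C C * (V * β * (3 * m / (1 + 2 / m))) := by
      have h3 := mul_le_mul_of_nonneg_left h1 (by linarith : 0 ≤ 3 * ip3 C C)
      have h4 := mul_le_mul_of_nonneg_left hcs (by linarith : 0 ≤ m)
      linarith
    have h5 : 0 < 9 * m * V := by positivity
    refine le_of_mul_le_mul_left ?_ h5
    have h6 := mul_le_mul_of_nonneg_left h2 (by positivity : 0 ≤ 1 + 2 / m)
    have e6 : (1 + 2 / m) * (3 * ip3 C C * (V * β * (3 * m / (1 + 2 / m)))) =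
        9 * m * V * (β * ip3 C C) := by
      field_simp
      ring
    rw [e6] at h6
    linarith

end TensorAlgebra

end Heisenberg

namespace Heisenberg

/-! ### Pointwise algebraic form of the improved inequality. -/

section TensorAlgebra

variable {ι : Type*} [Fintype ι]

/-- Pairing with a tensor that has a factor `z` contracts that slot with `z`; hence an `X`
annihilated by `z` is orthogonal to all such tensors. -/
theorem ip3_mul_first (X : ι → ι → ι → ℝ) (z : ι → ℝ) (Q : ι → ι → ℝ) :
    ip3 X (fun i j k => z i * Q j k) = ip2 (fun j k => ∑ i, X i j k * z i) Q := by
  simp only [ip3, ip2, Finset.sum_mul]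
  rw [Finset.sum_comm]
  refine Finset.sum_congr rfl fun j _ => ?_
  rw [Finset.sum_comm]
  exact Finset.sum_congr rfl fun k _ => Finset.sum_congr rfl fun i _ => by ring

theorem ip3_mul_second (X : ι → ι → ι → ℝ) (z : ι → ℝ) (Q : ι → ι → ℝ) :
    ip3 X (fun i j k => z j * Q i k) = ip2 (fun i k => ∑ j, X i j k * z j) Q := by
  rw [← ip3_mul_first (fun j i k => X i j k), ← ip3_swap_left]

theorem ip3_mul_third (X : ι → ι → ι → ℝ) (z : ι → ℝ) (Q : ι → ι → ℝ) :
    ip3 X (fun i j k => z k * Q i j) = ip2 (fun i j => ∑ k, X i j k * z k) Q := by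
  rw [← ip3_mul_second (fun i k j => X i j k), ← ip3_swap_right]

/-- The scalar inequality that remains once the tensors have been decomposed along `J(ν)`. -/
theorem scalar_kato_bound {m β l k : ℝ} (hm : 1 < m) (hk : 0 ≤ k) (hβ : 0 ≤ β)
    (h : m * l ^ 2 ≤ (m - 1) * β) :
    (1 + k / m) * (m * l ^ 2 + 2 * β) ^ 2 ≤
      β * ((m ^ 2 + 3 * m + k * (m - 1)) * l ^ 2 + (4 + 4 * k) * β) := by
  have hm0 : 0 < m := by linarith
  -- The gap factors through the defect `(m - 1) β - m l²` of the eigenvalue bound.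
  have e : m * (β * ((m ^ 2 + 3 * m + k * (m - 1)) * l ^ 2 + (4 + 4 * k) * β) -
      (1 + k / m) * (m * l ^ 2 + 2 * β) ^ 2) =
      (m ^ 2 * l ^ 2 + k * m * l ^ 2 + 4 * k * β) * ((m - 1) * β - m * l ^ 2) := by
    field_simp
    ring
  have h1 : 0 ≤ (m ^ 2 * l ^ 2 + k * m * l ^ 2 + 4 * k * β) * ((m - 1) * β - m * l ^ 2) :=
    mul_nonneg (by positivity) (by linarith)
  rw [← e] at h1
  have := nonneg_of_mul_nonneg_right h1 hm0
  linarith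

variable [DecidableEq ι]

set_option maxHeartbeats 1000000 in
/-- The pointwise algebraic form of the improved Kato inequality. In an orthonormal frame, `B` is
the symmetric second fundamental form, `C` its covariant derivative, `om` the complex structure and
`z` the vector `J(ν)`. -/
theorem improved_kato_pointwise {B om : ι → ι → ℝ} {C : ι → ι → ι → ℝ} {z lam : ι → ℝ}
    {a b l k : ℝ} (hm : 2 ≤ Fintype.card ι) (hk : k ∈ Set.Icc (0 : ℝ) 2)
    (hB : ∀ i j, B i j = B j i) (htr : ∑ i, B i i = 0) (hom : ∀ i j, om i j = -om j i)
    (homom : ∀ i j, ∑ s, om i s * om j s = idm i j - z i * z j) (homz : ∀ i, ∑ s, om i s * z s = 0)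
    (hz : ∑ i, z i * z i = 1) (hBz : ∀ i, ∑ j, B i j * z j = l * z i)
    (hC : ∀ i j k, C i j k = C i k j) (hCtr : ∀ i, ∑ j, C i j j = 0)
    (hcod : ∀ i j k, C i j k - C j i k =
      -b * (2 * om i j * z k + z j * om i k - z i * om j k) + a * (B i k * z j - B j k * z i))
    (hCz : ∀ i j, ∑ k, C i j k * z k = lam i * z j + l * (∑ s, (B i s - a * om i s) * om s j) -
      ∑ k, B j k * (∑ s, (B i s - a * om i s) * om s k)) :
    (1 + k / (Fintype.card ι : ℝ)) * ∑ i, ip2 B (C i) * ip2 B (C i) ≤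
      ip2 B B * ip3 C C + a ^ 2 * ip2 B B * ((4 * k - 2) * ip2 B B +
        (k * (Fintype.card ι - 1) - 2 * Fintype.card ι) * l ^ 2) := by
  have hm' : (2 : ℝ) ≤ Fintype.card ι := by exact_mod_cast hm
  have hpinch := card_mul_sq_mulVec_le hm hB htr hBz
  have hI : ip2 (idm : ι → ι → ℝ) idm = (Fintype.card ι : ℝ) := ip2_idm_idm
  set m : ℝ := (Fintype.card ι : ℝ) with hmdef
  set β := ip2 B B with hβ
  have hpinch' : m * l ^ 2 ≤ (m - 1) * β := by
    have : ∑ i, l * z i * (l * z i) = l ^ 2 := by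
      have : ∀ i, l * z i * (l * z i) = l ^ 2 * (z i * z i) := fun i => by ring
      simp only [this, ← Finset.mul_sum, hz, mul_one]
    rw [this, hz, mul_one] at hpinch
    exact hpinch
  -- In matrix notation `X = B ω` and `Y = B ω B`; the latter is antisymmetric, and both are killed
  -- by `z` on either side.
  set X : ι → ι → ℝ := fun i j => ∑ s, B i s * om s j with hX
  set Y : ι → ι → ℝ := fun i j => ∑ s, B j s * X i s with hY
  have hzom : ∀ j, ∑ s, z s * om s j = 0 := fun j => by
    rw [← neg_eq_zero, ← homz j, ← Finset.sum_neg_distrib]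
    exact Finset.sum_congr rfl fun s _ => by rw [hom s j]; ring
  have hzB : ∀ j, ∑ s, z s * B s j = l * z j := fun j => by
    rw [← hBz j]
    exact Finset.sum_congr rfl fun s _ => by rw [hB s j]; ring
  have hXz : ∀ i, ∑ j, X i j * z j = 0 := fun i => by
    simp only [hX, Finset.sum_mul]
    rw [Finset.sum_comm]
    simp only [mul_assoc, ← Finset.mul_sum, homz, mul_zero, Finset.sum_const_zero]
  have hzX : ∀ j, ∑ i, z i * X i j = 0 := fun j => by
    simp only [hX, Finset.mul_sum]
    rw [Finset.sum_comm]
    simp only [← mul_assoc, ← Finset.sum_mul, hzB]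
    simp only [mul_assoc, ← Finset.mul_sum, hzom, mul_zero]
  have hYz : ∀ i, ∑ j, Y i j * z j = 0 := fun i => by
    simp only [hY, Finset.sum_mul]
    rw [Finset.sum_comm]
    have : ∀ s j, B j s * X i s * z j = X i s * (z j * B j s) := fun s j => by ring
    simp only [this, ← Finset.mul_sum, hzB]
    have : ∀ s, X i s * (l * z s) = l * (X i s * z s) := fun s => by ring
    simp only [this, ← Finset.mul_sum, hXz, mul_zero]
  have hYanti : ∀ i j, Y i j = -Y j i := fun i j => by
    simp only [hY, hX, Finset.mul_sum]
    rw [Finset.sum_comm, ← Finset.sum_neg_distrib]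
    refine Finset.sum_congr rfl fun s _ => ?_
    rw [← Finset.sum_neg_distrib]
    refine Finset.sum_congr rfl fun t _ => ?_
    rw [hom s t]
    ring
  have hzY : ∀ j, ∑ i, z i * Y i j = 0 := fun j => by
    rw [← neg_eq_zero, ← hYz j, ← Finset.sum_neg_distrib]
    exact Finset.sum_congr rfl fun i _ => by rw [hYanti i j]; ring
  have hM : ∀ i j, ∑ s, (B i s - a * om i s) * om s j = X i j + a * (idm i j - z i * z j) :=
    fun i j => by
      rw [← homom, Finset.mul_sum, ← Finset.sum_add_distrib]
      exact Finset.sum_congr rfl fun s _ => by rw [hom j s]; ring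
  set P : ι → ι → ℝ := fun i j => ∑ k, C i j k * z k with hP
  -- Since `ω² = -(1 - z ⊗ z)`, the differentiated eigenvector equation becomes explicit up to the
  -- unknown `lam`.
  have hP1 : ∀ i j, P i j = lam i * z j + l * X i j + l * a * idm i j - Y i j - a * B i j :=
    fun i j => by
      have e : ∑ k, B j k * (X i k + a * (idm i k - z i * z k)) =
          Y i j + a * B i j - a * l * z i * z j := by
        have : ∀ k, B j k * (X i k + a * (idm i k - z i * z k)) =
            B j k * X i k + a * (B j k * idm i k) - a * z i * (B j k * z k) := fun k => by ring
        simp only [this, Finset.sum_sub_distrib, Finset.sum_add_distrib, ← Finset.mul_sum, hBz]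
        simp only [idm, mul_ite, mul_one, mul_zero, Finset.sum_ite_eq, Finset.mem_univ, if_true,
          hB j i, hY]
        ring
      simp only [hP, hCz, hM, e]
      ring
  have hidz : ∀ i, ∑ j, idm i j * z j = z i := fun i => by simp [idm]
  have hPz0 : ∀ i, ∑ j, P i j * z j = lam i := fun i => by
    have : ∀ j, P i j * z j = lam i * (z j * z j) + l * (X i j * z j) + l * a * (idm i j * z j) -
        Y i j * z j - a * (B i j * z j) := fun j => by rw [hP1]; ring
    simp only [this, Finset.sum_sub_distrib, Finset.sum_add_distrib, ← Finset.mul_sum, hz, hXz,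
      hidz, hYz, hBz]
    ring
  set μ := ∑ i, z i * lam i with hμ
  have hzP0 : ∀ j, ∑ i, z i * P i j = μ * z j := fun j => by
    have : ∀ i, z i * P i j = z i * lam i * z j + l * (z i * X i j) + l * a * (idm j i * z i) -
        z i * Y i j - a * (z i * B i j) := fun i => by rw [hP1, idm_symm]; ring
    simp only [this, Finset.sum_sub_distrib, Finset.sum_add_distrib, ← Finset.mul_sum, hzX,
      ← Finset.sum_mul, hidz, hzY, hzB, ← hμ]
    ring
  have hP2 : ∀ i k, ∑ j, C i j k * z j = P i k := fun i k => by
    simp only [hP, hC i k]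
  set Q : ι → ι → ℝ := fun j k => ∑ i, C i j k * z i with hQ
  have hQsymm : ∀ i j, Q i j = Q j i := fun i j => by simp only [hQ, hC _ i j]
  -- This is the Codazzi relation contracted with `z` in its second index.
  have hPQ : ∀ i k, P i k - Q i k = -b * om i k + a * (B i k - l * z i * z k) := fun i k => by
    rw [← hP2]
    simp only [hQ, ← Finset.sum_sub_distrib, ← sub_mul, hcod]
    have : ∀ j, (-b * (2 * om i j * z k + z j * om i k - z i * om j k) +
        a * (B i k * z j - B j k * z i)) * z j = -b * (2 * z k * (om i j * z j) +
        om i k * (z j * z j) - z i * (z j * om j k)) + a * (B i k * (z j * z j) -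
        z i * (z j * B j k)) := fun j => by ring
    simp only [this, Finset.sum_add_distrib, ← Finset.mul_sum, Finset.sum_sub_distrib, homz, hz,
      hzom, hzB]
    ring
  -- `P - Q` annihilates `z`, while `P z = lam` and, by the symmetry of `C` in its last two slots,
  -- `Q z` is the transpose of `P` applied to `z`, that is `μ z`.
  have hlam : ∀ i, lam i = μ * z i := fun i => by
    have h1 : ∑ k, (P i k - Q i k) * z k = 0 := by
      have : ∀ k, (P i k - Q i k) * z k = -b * (om i k * z k) + a * (B i k * z k) -
          a * l * z i * (z k * z k) := fun k => by rw [hPQ]; ring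
      simp only [this, Finset.sum_add_distrib, ← Finset.mul_sum, Finset.sum_sub_distrib, homz, hz,
        hBz]
      ring
    have h2 : ∑ k, Q i k * z k = ∑ j, z j * P j i := by
      simp only [hQ, hP, Finset.sum_mul, Finset.mul_sum]
      rw [Finset.sum_comm]
      exact Finset.sum_congr rfl fun _ _ => Finset.sum_congr rfl fun _ _ => by ring
    simp only [sub_mul, Finset.sum_sub_distrib, hPz0, h2, hzP0] at h1
    linarith
  have hPz : ∀ i, ∑ j, P i j * z j = μ * z i := fun i => by rw [hPz0, hlam]
  set K : ι → ι → ℝ := fun i j => (X i j + X j i) / 2 with hK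
  set S : ι → ι → ℝ := μ • tens z z + l • K + (l * a) • idm - a • B with hS
  set R : ι → ι → ℝ := fun i j => l * (X i j - X j i) / 2 - Y i j with hR
  have hPS : P = S + R := by
    ext i j
    simp only [hP1, hlam, hS, hR, hK, tens, Pi.add_apply, Pi.sub_apply, Pi.smul_apply,
      smul_eq_mul]
    ring
  have hKsymm : ∀ i j, K i j = K j i := fun i j => by simp only [hK, add_comm]
  have hSsymm : ∀ i j, S i j = S j i := fun i j => by
    simp only [hS, tens, Pi.add_apply, Pi.sub_apply, Pi.smul_apply, smul_eq_mul]
    rw [hKsymm i j, idm_symm i j, hB i j]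
    ring
  have hRanti : ∀ i j, R i j = -R j i := fun i j => by
    simp only [hR]
    rw [hYanti i j]
    ring
  -- `Q` is symmetric, so the antisymmetric part of `P - Q` is that of `P`, and Codazzi identifies
  -- it.
  have hRom : ∀ i j, R i j = -b * om i j := fun i j => by
    have h1 := hPQ i j
    have h2 := hPQ j i
    simp only [hPS, Pi.add_apply] at h1 h2
    rw [hSsymm j i, hRanti j i, hQsymm j i, hom j i, hB j i] at h2
    linarith
  have hQS : Q = S - a • B + (a * l) • tens z z := by
    ext i j
    have h1 := hPQ i j
    simp only [hPS, Pi.add_apply, hRom] at h1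
    simp only [tens, Pi.add_apply, Pi.sub_apply, Pi.smul_apply, smul_eq_mul]
    linarith
  have hQz : ∀ i, ∑ j, Q i j * z j = μ * z i := fun i => by
    have : ∑ k, Q i k * z k = ∑ j, z j * P j i := by
      simp only [hQ, hP, Finset.sum_mul, Finset.mul_sum]
      rw [Finset.sum_comm]
      exact Finset.sum_congr rfl fun _ _ => Finset.sum_congr rfl fun _ _ => by ring
    rw [this, hzP0]
  -- the pairings of the building blocks
  have hXtr : ∑ i, X i i = 0 := by
    have : ∑ i, X i i = ip2 B (fun i s => om s i) := rfl
    rw [this]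
    exact ip2_eq_zero_of_symm_antisymm hB fun i j => hom j i
  have zz : ip2 (tens z z) (tens z z) = 1 := by rw [ip2_tens_tens, hz, mul_one]
  have zI : ip2 (tens z z) idm = 1 := by rw [ip2_idm]; exact hz
  have BI : ip2 B idm = 0 := by rw [ip2_idm, htr]
  have KI : ip2 K idm = 0 := by
    rw [ip2_idm]
    simp only [hK, add_self_div_two, hXtr]
  have Bz : ip2 B (tens z z) = l := by
    rw [ip2_tens_right]
    simp only [hBz]
    have : ∀ i, z i * (l * z i) = l * (z i * z i) := fun i => by ring
    simp only [this, ← Finset.mul_sum, hz, mul_one]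
  have Kz : ip2 K (tens z z) = 0 := by
    have hKz : ∀ i, ∑ j, K i j * z j = 0 := fun i => by
      have : ∀ j, K i j * z j = (1 / 2) * (X i j * z j) + (1 / 2) * (z j * X j i) := fun j => by
        simp only [hK]
        ring
      simp only [this, Finset.sum_add_distrib, ← Finset.mul_sum, hXz, hzX]
      ring
    rw [ip2_tens_right]
    simp only [hKz, mul_zero, Finset.sum_const_zero]
  have XB : ip2 X B = 0 := by
    have : ip2 X B = ip2 (fun s j => ∑ i, B i s * B i j) om := by
      simp only [ip2, hX, Finset.sum_mul]
      rw [Finset.sum_comm' (t' := Finset.univ) (s' := fun _ => Finset.univ) (by simp)]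
      have h1 : ∀ j, ∑ i, ∑ s, B i s * om s j * B i j = ∑ s, ∑ i, B i s * B i j * om s j :=
        fun j => by
          rw [Finset.sum_comm]
          exact Finset.sum_congr rfl fun _ _ => Finset.sum_congr rfl fun _ _ => by ring
      simp only [h1]
      exact Finset.sum_comm
    rw [this]
    refine ip2_eq_zero_of_symm_antisymm (fun i j => ?_) hom
    exact Finset.sum_congr rfl fun _ _ => mul_comm _ _
  have KB : ip2 K B = 0 := by
    have h1 : K = (1 / 2 : ℝ) • (X + fun i j => X j i) := by
      ext i j
      simp only [hK, Pi.smul_apply, Pi.add_apply, smul_eq_mul]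
      ring
    have h2 : ip2 (fun i j => X j i) B = ip2 X B := by
      rw [← ip2_transpose]
      congr 1
      ext i j
      exact hB j i
    rw [h1, ip2_smul_left, ip2_add_left, h2, XB]
    ring
  -- The trace of `Q` vanishes because every slice of `C` is trace-free; this fixes the last
  -- unknown.
  have hμval : μ = -(m + 1) * (a * l) := by
    have h1 : ip2 Q idm = 0 := by
      rw [ip2_idm]
      simp only [hQ]
      rw [Finset.sum_comm]
      simp only [← Finset.sum_mul, hCtr, zero_mul, Finset.sum_const_zero]
    rw [hQS, hS] at h1
    simp only [ip2_add_left, ip2_sub_left, ip2_smul_left, zI, KI, BI, hI] at h1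
    linarith
  have hKK := ip2_self_nonneg K
  have hBQ : ip2 B Q = -a * (m * l ^ 2 + 2 * β) := by
    rw [hQS, hS]
    simp only [ip2_add_right, ip2_sub_right, ip2_smul_right, Bz, ip2_comm B K, KB, BI, ← hβ]
    rw [hμval]
    ring
  have hSS : ip2 S S = l ^ 2 * ip2 K K + a ^ 2 * ((m ^ 2 + 3 * m + 1) * l ^ 2 + β) := by
    rw [hS]
    simp only [ip2_add_right, ip2_sub_right, ip2_smul_right, ip2_add_left, ip2_sub_left,
      ip2_smul_left, Bz, ip2_comm B K, ip2_comm (tens z z) K, ip2_comm idm, ip2_comm (tens z z) B,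
      zz, zI, KB, BI, KI, Kz, hI, ← hβ]
    rw [hμval]
    ring
  have hQQ : ip2 Q Q = l ^ 2 * ip2 K K + a ^ 2 * ((m ^ 2 + 3 * m) * l ^ 2 + 4 * β) := by
    rw [hQS, hS]
    simp only [ip2_add_right, ip2_sub_right, ip2_smul_right, ip2_add_left, ip2_sub_left,
      ip2_smul_left, Bz, ip2_comm B K, ip2_comm (tens z z) K, ip2_comm idm, ip2_comm (tens z z) B,
      zz, zI, KB, BI, KI, Kz, hI, ← hβ]
    rw [hμval]
    ring
  -- `S` and `R` are orthogonal as symmetric and antisymmetric parts of `P`; only a lower bound is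
  -- needed, so `R` is dropped.
  have hPP : ip2 S S ≤ ip2 P P := by
    have hSR : ip2 S R = 0 := ip2_eq_zero_of_symm_antisymm hSsymm hRanti
    have hRR := ip2_self_nonneg R
    rw [hPS]
    simp only [ip2_add_left, ip2_add_right, hSR, ip2_comm R S]
    linarith
  -- the part of `C` orthogonal to `z`
  set Z1 : ι → ι → ι → ℝ := fun i j k => z i * Q j k with hZ1
  set Z2 : ι → ι → ι → ℝ := fun i j k => z j * P i k with hZ2
  set Z3 : ι → ι → ι → ℝ := fun i j k => z k * P i j with hZ3
  set Z4 : ι → ι → ι → ℝ := fun i j k => z i * tens z z j k with hZ4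
  -- Inclusion–exclusion over the slots: each double contraction with `z` gives `μ z`, so the
  -- coefficient of `z ⊗ z ⊗ z` is `3μ - μ = 2μ`.
  set C' : ι → ι → ι → ℝ := C - Z1 - Z2 - Z3 + (2 * μ) • Z4 with hC'
  have hC'app : ∀ i j k, C' i j k =
      C i j k - z i * Q j k - z j * P i k - z k * P i j + 2 * μ * (z i * (z j * z k)) :=
    fun i j k => rfl
  have C'2 : ∀ i j k, C' i j k = C' i k j := fun i j k => by
    rw [hC'app, hC'app, hC i j k, hQsymm j k]
    ring
  -- The Codazzi defect of `C` consists of terms with a factor `z`, and these are exactly those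
  -- produced by the subtracted contractions.
  have C'1 : ∀ i j k, C' i j k = C' j i k := fun i j k => by
    rw [hC'app, hC'app]
    have h1 := hcod i j k
    have h2 := hPQ i k
    have h3 := hPQ j k
    have h4 : P i j - P j i = -2 * b * om i j := by
      simp only [hPS, Pi.add_apply, hRom]
      rw [hSsymm j i, hom j i]
      ring
    linear_combination h1 - z j * h2 + z i * h3 - z k * h4
  have C'z : ∀ i j, ∑ k, C' i j k * z k = 0 := fun i j => by
    have : ∀ k, C' i j k * z k = C i j k * z k - z i * (Q j k * z k) - z j * (P i k * z k) -
        P i j * (z k * z k) + 2 * μ * (z i * z j) * (z k * z k) := fun k => by rw [hC'app]; ring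
    simp only [this, Finset.sum_add_distrib, Finset.sum_sub_distrib, ← Finset.mul_sum, hQz, hPz,
      hz]
    simp only [hP]
    ring
  have C'z2 : ∀ i k, ∑ j, C' i j k * z j = 0 := fun i k => by
    simp only [C'2 i _ k, C'z]
  have C'z1 : ∀ j k, ∑ i, C' i j k * z i = 0 := fun j k => by
    simp only [C'1 _ j k, C'z2]
  have C'tr : ∀ i, ∑ j, C' i j j = 0 := fun i => by
    have h0 : ∑ j, Q j j = 0 := by
      simp only [hQ]
      rw [Finset.sum_comm]
      simp only [← Finset.sum_mul, hCtr, zero_mul, Finset.sum_const_zero]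
    have : ∀ j, C' i j j = C i j j - z i * Q j j - 2 * (P i j * z j) +
        2 * μ * z i * (z j * z j) := fun j => by rw [hC'app]; ring
    simp only [this, Finset.sum_add_distrib, Finset.sum_sub_distrib, ← Finset.mul_sum, hPz,
      hz, h0, hCtr]
    ring
  have hkato := kato_of_symm_traceless hm hB htr C'1 C'2 C'tr
  have hzero : ∀ W : ι → ι → ℝ, ip2 (fun _ _ => 0) W = 0 := fun W => by simp [ip2]
  have hCC : ip3 C' C' = ip3 C C - (ip2 Q Q + 2 * ip2 P P - 2 * μ ^ 2) := by
    have e1 : ip3 C' C' = ip3 C' C := by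
      have h1 : ip3 C' C' = ip3 C' (C - Z1 - Z2 - Z3 + (2 * μ) • Z4) := rfl
      rw [h1]
      simp only [ip3_add_right, ip3_sub_right, ip3_smul_right, hZ1, hZ2, hZ3, hZ4, ip3_mul_first,
        ip3_mul_second, ip3_mul_third, C'z, C'z1, C'z2, hzero]
      ring
    have hQzz : ip2 Q (tens z z) = μ := by
      rw [ip2_tens_right]
      simp only [hQz]
      have : ∀ i, z i * (μ * z i) = μ * (z i * z i) := fun i => by ring
      simp only [this, ← Finset.mul_sum, hz, mul_one]
    rw [e1, ip3_comm, hC']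
    simp only [ip3_add_right, ip3_sub_right, ip3_smul_right, hZ1, hZ2, hZ3, hZ4, ip3_mul_first,
      ip3_mul_second, ip3_mul_third, hP2]
    rw [hQzz]
    ring
  -- As `B z = l z` and `P z = μ z`, the two terms from `P` contribute `2 l μ z_i`, which the `z ⊗ z
  -- ⊗ z` correction cancels.
  have hv : ∀ i, ip2 B (C i) = ip2 B (C' i) + z i * ip2 B Q := fun i => by
    have e1 : C i = C' i + z i • Q + tens z (P i) + tens (P i) z - (2 * μ * z i) • tens z z := by
      ext j k
      simp only [Pi.add_apply, Pi.sub_apply, Pi.smul_apply, smul_eq_mul, hC'app, tens]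
      ring
    have e2 : ip2 B (tens (P i) z) = l * (μ * z i) := by
      rw [ip2_tens_right, ← hPz, Finset.mul_sum]
      exact Finset.sum_congr rfl fun j _ => by rw [hBz]; ring
    have e3 : ip2 B (tens z (P i)) = l * (μ * z i) := by
      rw [← e2, ← ip2_transpose]
      congr 1
      · ext j k
        exact hB k j
      · ext j k
        exact mul_comm _ _
    rw [e1]
    simp only [ip2_add_right, ip2_sub_right, ip2_smul_right, e2, e3, Bz]
    ring
  -- The vector `⟨B, C'_i⟩` is orthogonal to `z`, so the squares add without a cross term.
  have hvv : ∑ i, ip2 B (C i) * ip2 B (C i) =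
      (∑ i, ip2 B (C' i) * ip2 B (C' i)) + ip2 B Q ^ 2 := by
    have e1 : ∑ i, z i * ip2 B (C' i) = 0 := by
      have h1 : ip3 (fun i j k => z i * B j k) C' = 0 := by
        rw [ip3_comm, ip3_mul_first]
        simp only [C'z1, hzero]
      rw [← h1]
      simp only [ip3, ip2, Finset.mul_sum, mul_assoc]
    have e2 : ∀ i, ip2 B (C i) * ip2 B (C i) = ip2 B (C' i) * ip2 B (C' i) +
        2 * ip2 B Q * (z i * ip2 B (C' i)) + ip2 B Q ^ 2 * (z i * z i) := fun i => by
      rw [hv]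
      ring
    simp only [e2, Finset.sum_add_distrib, ← Finset.mul_sum, e1, hz]
    ring
  have hβ0 : 0 ≤ β := ip2_self_nonneg B
  have hscal := scalar_kato_bound (by linarith : 1 < m) hk.1 hβ0 hpinch'
  set V' := ∑ i, ip2 B (C' i) * ip2 B (C' i) with hV'
  have hV0 : 0 ≤ V' := Finset.sum_nonneg fun _ _ => mul_self_nonneg _
  -- The only use of `k ≤ 2`: the refined inequality has constant `1 + 2/m`.
  have hkato2 : (1 + k / m) * V' ≤ β * ip3 C' C' := by
    refine le_trans (mul_le_mul_of_nonneg_right ?_ hV0) hkato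
    have := div_le_div_of_nonneg_right hk.2 (by linarith : (0 : ℝ) ≤ m)
    linarith
  have hscal2 := mul_le_mul_of_nonneg_left hscal (sq_nonneg a)
  -- The nonnegative `|K|²` terms are discarded; `2μ²` cancels `2 (m + 1)² a² l²` from the other
  -- norms.
  have hlow : a ^ 2 * ((m ^ 2 + 5 * m) * l ^ 2 + 6 * β) ≤ ip2 Q Q + 2 * ip2 P P - 2 * μ ^ 2 := by
    have h1 : 0 ≤ l ^ 2 * ip2 K K := by positivity
    rw [hSS] at hPP
    rw [hμval, hQQ]
    linarith
  have hlow2 := mul_le_mul_of_nonneg_left hlow hβ0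
  rw [hvv, hBQ]
  rw [hCC] at hkato2
  linarith

end TensorAlgebra

end Heisenberg

namespace Heisenberg

/-! ### Directional derivatives and Lie brackets on the hypersurface. -/

section Calculus

variable {n : ℕ} {M : Type*} [TopologicalSpace M] [ChartedSpace (EuclideanSpace ℝ (Fin (2 * n))) M]
variable {F F' G : Type*} [NormedAddCommGroup F] [NormedSpace ℝ F] [NormedAddCommGroup F']
  [NormedSpace ℝ F'] [NormedAddCommGroup G] [NormedSpace ℝ G]

/-- Differentiability at `p` of a vector-valued function on the hypersurface. -/
abbrev DiffAt (n : ℕ) {M : Type*} [TopologicalSpace M]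
    [ChartedSpace (EuclideanSpace ℝ (Fin (2 * n))) M] {F : Type*} [NormedAddCommGroup F]
    [NormedSpace ℝ F] (f : M → F) (p : M) : Prop :=
  MDifferentiableAt (𝓡 (2 * n)) 𝓘(ℝ, F) f p

/-- Smoothness on `U` of a vector-valued function on the hypersurface. -/
abbrev SmoothOn (n : ℕ) {M : Type*} [TopologicalSpace M]
    [ChartedSpace (EuclideanSpace ℝ (Fin (2 * n))) M] {F : Type*} [NormedAddCommGroup F]
    [NormedSpace ℝ F] (f : M → F) (U : Set M) : Prop :=
  ContMDiffOn (𝓡 (2 * n)) 𝓘(ℝ, F) ∞ f U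

theorem two_le_smooth : (2 : WithTop ℕ∞) ≤ ∞ := by
  have h : ((2 : ℕ∞) : WithTop ℕ∞) ≤ ((⊤ : ℕ∞) : WithTop ℕ∞) := WithTop.coe_le_coe.2 le_top
  exact h

theorem one_add_one_le_smooth : (1 + 1 : WithTop ℕ∞) ≤ ∞ := by
  rw [one_add_one_eq_two]
  exact two_le_smooth

theorem SmoothOn.diffAt {f : M → F} {U : Set M} {p : M} (hf : SmoothOn n f U) (hU : IsOpen U)
    (hp : p ∈ U) : DiffAt n f p :=
  (hf.contMDiffAt (hU.mem_nhds hp)).mdifferentiableAt (by simp)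

theorem dir_add_vec (f : M → F) (p : M) (X Y : TS n p) :
    dir f p (X + Y) = dir f p X + dir f p Y :=
  map_add (mfderiv (𝓡 (2 * n)) 𝓘(ℝ, F) f p) X Y

theorem dir_smul_vec (f : M → F) (p : M) (c : ℝ) (X : TS n p) :
    dir f p (c • X) = c • dir f p X :=
  map_smul (mfderiv (𝓡 (2 * n)) 𝓘(ℝ, F) f p) c X

theorem dir_sum_vec {κ : Type*} (f : M → F) (p : M) (s : Finset κ) (X : κ → TS n p) :
    dir f p (∑ i ∈ s, X i) = ∑ i ∈ s, dir f p (X i) :=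
  map_sum (mfderiv (𝓡 (2 * n)) 𝓘(ℝ, F) f p) X s

theorem dir_congr {f g : M → F} {U : Set M} {p : M} (hU : IsOpen U) (hp : p ∈ U)
    (h : ∀ q ∈ U, f q = g q) (X : TS n p) : dir f p X = dir g p X := by
  have : f =ᶠ[nhds p] g := Filter.eventually_of_mem (hU.mem_nhds hp) h
  exact congrArg (fun L => L X) (this.mfderiv_eq (I := 𝓡 (2 * n)) (I' := 𝓘(ℝ, F)))

theorem dir_const (c : F) (p : M) (X : TS n p) : dir (fun _ : M => c) p X = 0 := by
  have := mfderiv_const (I := 𝓡 (2 * n)) (I' := 𝓘(ℝ, F)) (x := p) (c := c)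
  exact congrArg (fun L => L X) this

theorem DiffAt.comp {f : M → F} {p : M} {g : F → G} (hg : DifferentiableAt ℝ g (f p))
    (hf : DiffAt n f p) : DiffAt n (fun q => g (f q)) p :=
  MDifferentiableAt.comp p hg.mdifferentiableAt hf

theorem dir_comp {f : M → F} {p : M} {g : F → G} (hg : DifferentiableAt ℝ g (f p))
    (hf : DiffAt n f p) (X : TS n p) :
    dir (fun q => g (f q)) p X = fderiv ℝ g (f p) (dir f p X) := by
  have h1 := mfderiv_comp (I := 𝓡 (2 * n)) (I' := 𝓘(ℝ, F)) (I'' := 𝓘(ℝ, G)) p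
    hg.mdifferentiableAt hf
  have h3 := congrArg (fun L => L X) h1
  rw [mfderiv_eq_fderiv] at h3
  exact h3

theorem DiffAt.clm {f : M → F} {p : M} (L : F →L[ℝ] G) (hf : DiffAt n f p) :
    DiffAt n (fun q => L (f q)) p :=
  DiffAt.comp (L.differentiableAt) hf

theorem dir_clm {f : M → F} {p : M} (L : F →L[ℝ] G) (hf : DiffAt n f p) (X : TS n p) :
    dir (fun q => L (f q)) p X = L (dir f p X) := by
  rw [dir_comp L.differentiableAt hf, L.fderiv]

theorem DiffAt.prodMk {f : M → F} {g : M → F'} {p : M} (hf : DiffAt n f p) (hg : DiffAt n g p) :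
    DiffAt n (fun q => (f q, g q)) p :=
  MDifferentiableAt.prodMk_space hf hg

theorem DiffAt.bilin {f : M → F} {g : M → F'} {p : M} (L : F →L[ℝ] F' →L[ℝ] G)
    (hf : DiffAt n f p) (hg : DiffAt n g p) : DiffAt n (fun q => L (f q) (g q)) p :=
  DiffAt.comp (f := fun q => (f q, g q)) (g := fun x : F × F' => L x.1 x.2)
    (L.isBoundedBilinearMap.differentiableAt _) (hf.prodMk hg)

theorem dir_bilin {f : M → F} {g : M → F'} {p : M} (L : F →L[ℝ] F' →L[ℝ] G)
    (hf : DiffAt n f p) (hg : DiffAt n g p) (X : TS n p) :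
    dir (fun q => L (f q) (g q)) p X = L (dir f p X) (g p) + L (f p) (dir g p X) := by
  have hfg := hf.prodMk hg
  have h1 := dir_clm (ContinuousLinearMap.fst ℝ F F') hfg X
  have h2 := dir_clm (ContinuousLinearMap.snd ℝ F F') hfg X
  have h := dir_comp (f := fun q => (f q, g q)) (g := fun x : F × F' => L x.1 x.2)
    (L.isBoundedBilinearMap.differentiableAt _) hfg X
  have h3 : fderiv ℝ (fun x : F × F' => L x.1 x.2) (f p, g p) = _ :=
    L.isBoundedBilinearMap.fderiv (f p, g p)
  simp only [h3] at h
  rw [h, IsBoundedBilinearMap.deriv_apply, add_comm]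
  exact congrArg₂ (fun u v => L u (g p) + L (f p) v) h1.symm h2.symm

theorem DiffAt.add {f g : M → F} {p : M} (hf : DiffAt n f p) (hg : DiffAt n g p) :
    DiffAt n (fun q => f q + g q) p :=
  MDifferentiableAt.add hf hg

theorem dir_add {f g : M → F} {p : M} (hf : DiffAt n f p) (hg : DiffAt n g p) (X : TS n p) :
    dir (fun q => f q + g q) p X = dir f p X + dir g p X := by
  have h := dir_clm (ContinuousLinearMap.fst ℝ F F + ContinuousLinearMap.snd ℝ F F)
    (hf.prodMk hg) X
  have h1 := dir_clm (ContinuousLinearMap.fst ℝ F F) (hf.prodMk hg) X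
  have h2 := dir_clm (ContinuousLinearMap.snd ℝ F F) (hf.prodMk hg) X
  exact h.trans (congrArg₂ (· + ·) h1.symm h2.symm)

theorem DiffAt.sum {κ : Type*} {s : Finset κ} {f : κ → M → F} {p : M}
    (hf : ∀ i ∈ s, DiffAt n (f i) p) : DiffAt n (fun q => ∑ i ∈ s, f i q) p := by
  classical
  induction s using Finset.induction_on with
  | empty => simpa using mdifferentiableAt_const (c := (0 : F))
  | insert i s hi ih =>
    simp only [Finset.sum_insert hi]
    exact (hf i (Finset.mem_insert_self i s)).add
      (ih fun j hj => hf j (Finset.mem_insert_of_mem hj))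

theorem dir_sum {κ : Type*} {s : Finset κ} {f : κ → M → F} {p : M}
    (hf : ∀ i ∈ s, DiffAt n (f i) p) (X : TS n p) :
    dir (fun q => ∑ i ∈ s, f i q) p X = ∑ i ∈ s, dir (f i) p X := by
  classical
  induction s using Finset.induction_on with
  | empty => simpa using dir_const (0 : F) p X
  | insert i s hi ih =>
    simp only [Finset.sum_insert hi]
    rw [dir_add (hf i (Finset.mem_insert_self i s))
      (DiffAt.sum fun j hj => hf j (Finset.mem_insert_of_mem hj)),
      ih fun j hj => hf j (Finset.mem_insert_of_mem hj)]

theorem DiffAt.mul {f g : M → ℝ} {p : M} (hf : DiffAt n f p) (hg : DiffAt n g p) :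
    DiffAt n (fun q => f q * g q) p :=
  DiffAt.bilin (ContinuousLinearMap.mul ℝ ℝ) hf hg

theorem dir_mul {f g : M → ℝ} {p : M} (hf : DiffAt n f p) (hg : DiffAt n g p) (X : TS n p) :
    dir (fun q => f q * g q) p X = dir f p X * g p + f p * dir g p X :=
  dir_bilin (ContinuousLinearMap.mul ℝ ℝ) hf hg X

variable {V : Type*} [NormedAddCommGroup V] [InnerProductSpace ℝ V]

theorem DiffAt.inner {f g : M → V} {p : M} (hf : DiffAt n f p) (hg : DiffAt n g p) :
    DiffAt n (fun q => inner ℝ (f q) (g q)) p :=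
  DiffAt.bilin (innerSL ℝ) hf hg

theorem dir_inner {f g : M → V} {p : M} (hf : DiffAt n f p) (hg : DiffAt n g p) (X : TS n p) :
    dir (fun q => inner ℝ (f q) (g q)) p X =
      inner ℝ (dir f p X) (g p) + inner ℝ (f p) (dir g p X) :=
  dir_bilin (innerSL ℝ) hf hg X

/-! ### Vector fields in a chart -/

variable [IsManifold (𝓡 (2 * n)) ∞ M]

/-- The chart at `p`, as a function with values in the model space. -/
noncomputable abbrev chartMap (n : ℕ) {M : Type*} [TopologicalSpace M]
    [ChartedSpace (EuclideanSpace ℝ (Fin (2 * n))) M] (p : M) : M → EuclideanSpace ℝ (Fin (2 * n)) :=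
  extChartAt (𝓡 (2 * n)) p

theorem chartMap_diffAt {p q : M} (hq : q ∈ (extChartAt (𝓡 (2 * n)) p).source) :
    DiffAt n (chartMap n p) q := by
  have : IsManifold (𝓡 (2 * n)) 1 M := .of_le (n := ∞) (by simp)
  exact mdifferentiableAt_extChartAt (by simpa using hq)

theorem exists_dir_chartMap {p q : M} (hq : q ∈ (extChartAt (𝓡 (2 * n)) p).source)
    (v : EuclideanSpace ℝ (Fin (2 * n))) : ∃ X : TS n q, dir (chartMap n p) q X = v := by
  have : IsManifold (𝓡 (2 * n)) 1 M := .of_le (n := ∞) (by simp)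
  obtain ⟨e, he⟩ := isInvertible_mfderiv_extChartAt (I := 𝓡 (2 * n)) hq
  refine ⟨e.symm v, ?_⟩
  change (mfderiv (𝓡 (2 * n)) 𝓘(ℝ, EuclideanSpace ℝ (Fin (2 * n))) (extChartAt (𝓡 (2 * n)) p) q)
    (e.symm v) = v
  rw [← he]
  exact e.apply_symm_apply v

/-- A smooth vector field has differentiable coordinates in the chart at `p`. -/
theorem diffAt_coordinates {X : ∀ q : M, TS n q} {U : Set M} {p : M} (hU : IsOpen U) (hp : p ∈ U)
    (hX : ContMDiffOn (𝓡 (2 * n)) (𝓡 (2 * n)).tangent ∞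
      (fun q => (⟨q, X q⟩ : TangentBundle (𝓡 (2 * n)) M)) U) :
    DiffAt n (fun q => dir (chartMap n p) q (X q)) p := by
  have : IsManifold (𝓡 (2 * n)) 1 M := .of_le (n := ∞) (by simp)
  have h1 := hX.contMDiffAt (hU.mem_nhds hp)
  have h2 : MDifferentiableAt (𝓡 (2 * n)) (𝓡 (2 * n)).tangent
      (fun q => (⟨q, X q⟩ : TangentBundle (𝓡 (2 * n)) M)) p := h1.mdifferentiableAt (by simp)
  rw [mdifferentiableAt_section] at h2
  refine h2.congr_of_eventuallyEq ?_
  filter_upwards [(chartAt (EuclideanSpace ℝ (Fin (2 * n))) p).open_source.mem_nhds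
    (mem_chart_source _ p)] with q hq
  have h3 := TangentBundle.continuousLinearMapAt_trivializationAt (I := 𝓡 (2 * n)) hq
  have h4 := congrArg (fun L => L (X q)) h3
  refine h4.symm.trans ?_
  exact Bundle.Trivialization.continuousLinearMapAt_apply_of_mem _ _ (by simpa using hq) _

/-- A smooth function on `U` factors, near `p`, through the chart at `p`. -/
theorem exists_chart_factor {f : M → F} {U : Set M} {p : M} (hf : SmoothOn n f U) (hU : IsOpen U)
    (hp : p ∈ U) : ∃ (g : EuclideanSpace ℝ (Fin (2 * n)) → F) (W : Set M), IsOpen W ∧ p ∈ W ∧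
      W ⊆ U ∧ W ⊆ (extChartAt (𝓡 (2 * n)) p).source ∧
      (∀ q ∈ W, ContDiffAt ℝ ∞ g (chartMap n p q)) ∧
      ∀ q ∈ W, ∀ X : TS n q, dir f q X = fderiv ℝ g (chartMap n p q) (dir (chartMap n p) q X) := by
  let g : EuclideanSpace ℝ (Fin (2 * n)) → F := f ∘ (extChartAt (𝓡 (2 * n)) p).symm
  let W : Set M := (extChartAt (𝓡 (2 * n)) p).source ∩ U
  have hWo : IsOpen W := (isOpen_extChartAt_source p).inter hU
  have hg : ∀ q ∈ W, ContDiffAt ℝ ∞ g (chartMap n p q) := fun q hq => by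
    have h1 : ContMDiffAt 𝓘(ℝ, EuclideanSpace ℝ (Fin (2 * n))) (𝓡 (2 * n)) ∞
        (extChartAt (𝓡 (2 * n)) p).symm (chartMap n p q) :=
      (contMDiffOn_extChartAt_symm p).contMDiffAt
        ((isOpen_extChartAt_target p).mem_nhds ((extChartAt (𝓡 (2 * n)) p).map_source hq.1))
    have h2 : ContMDiffAt (𝓡 (2 * n)) 𝓘(ℝ, F) ∞ f
        ((extChartAt (𝓡 (2 * n)) p).symm (chartMap n p q)) := by
      rw [(extChartAt (𝓡 (2 * n)) p).left_inv hq.1]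
      exact hf.contMDiffAt (hU.mem_nhds hq.2)
    exact (h2.comp _ h1).contDiffAt
  refine ⟨g, W, hWo, ⟨mem_extChartAt_source p, hp⟩, Set.inter_subset_right,
    Set.inter_subset_left, hg, fun q hq X => ?_⟩
  have h1 : ∀ q' ∈ W, f q' = g (chartMap n p q') := fun q' hq' => by
    change f q' = f _
    rw [(extChartAt (𝓡 (2 * n)) p).left_inv hq'.1]
  rw [dir_congr hWo hq h1]
  exact dir_comp ((hg q hq).differentiableAt (by simp)) (chartMap_diffAt hq.1) X

/-- The chain rule twice in the chart. The representative `g` does not depend on `Y`, so that the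
expressions for two vector fields can be subtracted and their Hessian terms compared. -/
theorem diffAt_dir_and_dir_dir {f : M → F} {U : Set M} {p : M} (hf : SmoothOn n f U)
    (hU : IsOpen U) (hp : p ∈ U) : ∃ (g : EuclideanSpace ℝ (Fin (2 * n)) → F),
      ContDiffAt ℝ ∞ g (chartMap n p p) ∧
      (∀ X : TS n p, dir f p X = fderiv ℝ g (chartMap n p p) (dir (chartMap n p) p X)) ∧
      ∀ Y : ∀ q : M, TS n q, DiffAt n (fun q => dir (chartMap n p) q (Y q)) p →
        DiffAt n (fun q => dir f q (Y q)) p ∧ ∀ X : TS n p, dir (fun q => dir f q (Y q)) p X =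
          fderiv ℝ (fderiv ℝ g) (chartMap n p p) (dir (chartMap n p) p X)
            (dir (chartMap n p) p (Y p)) +
          fderiv ℝ g (chartMap n p p) (dir (fun q => dir (chartMap n p) q (Y q)) p X) := by
  obtain ⟨g, W, hWo, hpW, -, hWs, hg, hfg⟩ := exists_chart_factor hf hU hp
  refine ⟨g, hg p hpW, hfg p hpW, fun Y hY => ?_⟩
  have h1 : ∀ q ∈ W, dir f q (Y q) = ContinuousLinearMap.id ℝ _
      (fderiv ℝ g (chartMap n p q)) (dir (chartMap n p) q (Y q)) := fun q hq => hfg q hq (Y q)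
  have hχ := chartMap_diffAt (n := n) (hWs hpW)
  have hg' : DifferentiableAt ℝ (fderiv ℝ g) (chartMap n p p) :=
    ((hg p hpW).fderiv_right (m := 1) one_add_one_le_smooth).differentiableAt (by simp)
  have h2 : DiffAt n (fun q => fderiv ℝ g (chartMap n p q)) p := DiffAt.comp hg' hχ
  refine ⟨(DiffAt.bilin (ContinuousLinearMap.id ℝ _) h2 hY).congr_of_eventuallyEq
    (Filter.eventually_of_mem (hWo.mem_nhds hpW) h1), fun X => ?_⟩
  rw [dir_congr hWo hpW h1, dir_bilin (ContinuousLinearMap.id ℝ _) h2 hY, dir_comp hg' hχ]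
  rfl

theorem diffAt_dir {f : M → F} {U : Set M} {p : M} (hf : SmoothOn n f U)
    (hU : IsOpen U) (hp : p ∈ U) {Y : ∀ q : M, TS n q}
    (hY : DiffAt n (fun q => dir (chartMap n p) q (Y q)) p) :
    DiffAt n (fun q => dir f q (Y q)) p := by
  obtain ⟨g, -, -, h⟩ := diffAt_dir_and_dir_dir hf hU hp
  exact (h Y hY).1

/-- The Lie bracket: the commutator of two vector fields acts on functions as a vector. -/
theorem exists_bracket {p : M} {X Y : ∀ q : M, TS n q}
    (hX : DiffAt n (fun q => dir (chartMap n p) q (X q)) p)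
    (hY : DiffAt n (fun q => dir (chartMap n p) q (Y q)) p) :
    ∃ Z : TS n p, ∀ (F : Type) [NormedAddCommGroup F] [NormedSpace ℝ F] (f : M → F) (U : Set M),
      IsOpen U → p ∈ U → SmoothOn n f U →
      dir (fun q => dir f q (Y q)) p (X p) - dir (fun q => dir f q (X q)) p (Y p) = dir f p Z := by
  -- The usual coordinate formula for the bracket; the Hessian terms cancel by symmetry of second
  -- derivatives.
  obtain ⟨Z, hZ⟩ := exists_dir_chartMap (n := n) (mem_extChartAt_source p)
    (dir (fun q => dir (chartMap n p) q (Y q)) p (X p) -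
      dir (fun q => dir (chartMap n p) q (X q)) p (Y p))
  refine ⟨Z, fun F _ _ f U hU hp hf => ?_⟩
  obtain ⟨g, hg, h1, h⟩ := diffAt_dir_and_dir_dir hf hU hp
  rw [(h Y hY).2, (h X hX).2, h1, hZ, map_sub]
  have hsymm : IsSymmSndFDerivAt ℝ g (chartMap n p p) := hg.isSymmSndFDerivAt (by simpa using two_le_smooth)
  rw [hsymm.eq (dir (chartMap n p) p (X p))]
  abel

/-- Every tangent vector extends to a vector field with constant coordinates in the chart. -/
theorem exists_extension {p : M} (v : TS n p) : ∃ X : ∀ q : M, TS n q, X p = v ∧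
    DiffAt n (fun q => dir (chartMap n p) q (X q)) p := by
  classical
  choose Y hY using fun q (hq : q ∈ (extChartAt (𝓡 (2 * n)) p).source) =>
    exists_dir_chartMap hq (dir (chartMap n p) p v)
  have hps := mem_extChartAt_source (I := 𝓡 (2 * n)) p
  -- The value at `p` is prescribed, so `X p = v` holds without appeal to injectivity of the chart
  -- derivative.
  let X : ∀ q : M, TS n q := Function.update
    (fun q => if hq : q ∈ (extChartAt (𝓡 (2 * n)) p).source then Y q hq else 0) p v
  refine ⟨X, Function.update_self _ _ _, ?_⟩
  have h : ∀ q ∈ (extChartAt (𝓡 (2 * n)) p).source,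
      dir (chartMap n p) q (X q) = dir (chartMap n p) p v := fun q hq => by
    by_cases h : q = p
    · subst h
      simp only [X, Function.update_self]
    · simp only [X, Function.update_of_ne h, hq, dif_pos, hY]
  exact (mdifferentiableAt_const (c := dir (chartMap n p) p v)).congr_of_eventuallyEq
    (Filter.eventually_of_mem ((isOpen_extChartAt_source p).mem_nhds hps) h)

end Calculus

end Heisenberg

namespace Heisenberg

/-! ### Linear algebra of `J` and of the left-invariant coefficients. -/

section Ambient

variable {n : ℕ}

theorem inner_T (v : Vec n) : inner ℝ v T = v (Sum.inr ()) := by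
  simp [T, EuclideanSpace.inner_single_right]

theorem inner_T_T : inner ℝ (T : Vec n) T = 1 := by
  simp [T]

theorem inner_J_T (v : Vec n) : inner ℝ (J v) T = 0 := by
  simp [inner_T, J]

theorem inner_J_left (u v : Vec n) : inner ℝ (J u) v = -inner ℝ u (J v) := by
  simp [PiLp.inner_apply, J, mul_comm]

theorem J_J (u : Vec n) : J (J u) = -u + inner ℝ u T • T := by
  rw [inner_T]
  ext j
  rcases j with (i | i) | i <;> simp [J, T]

theorem inner_J_J (u v : Vec n) :
    inner ℝ (J u) (J v) = inner ℝ u v - inner ℝ u T * inner ℝ v T := by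
  rw [inner_J_left, J_J, inner_add_right, inner_neg_right, inner_smul_right]
  ring

theorem mem_horizontal {v : Vec n} : v ∈ horizontal n ↔ inner ℝ v T = 0 := by
  rw [inner_T]
  constructor
  · intro hv
    refine Submodule.span_induction (p := fun (w : Vec n) _ => w (Sum.inr ()) = 0) ?_ ?_ ?_ ?_ hv
    · rintro _ ⟨i, rfl⟩
      simp
    · simp
    · intro x y _ _ hx hy
      simp [hx, hy]
    · intro c x _ hx
      simp [hx]
  · intro hv
    have : v = ∑ i : Fin n ⊕ Fin n, v (Sum.inl i) • EuclideanSpace.single (Sum.inl i) (1 : ℝ) := by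
      ext j
      rcases j with j | j
      · rcases j with j | j <;> simp [Finset.sum_apply, Pi.single_apply]
      · simpa [Finset.sum_apply, Pi.single_apply] using hv
    rw [this]
    exact Submodule.sum_mem _ fun i _ => Submodule.smul_mem _ _ (Submodule.subset_span ⟨i, rfl⟩)

theorem finrank_vec : Module.finrank ℝ (Vec n) = 2 * n + 1 := by
  rw [finrank_euclideanSpace]
  simp [Fintype.card_sum]
  ring

/-- `J` as a continuous linear map. -/
noncomputable def JL : Vec n →L[ℝ] Vec n := LinearMap.toContinuousLinearMap J

theorem JL_apply (v : Vec n) : JL v = J v := rfl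

/-- The bilinear form that describes how the coefficients of a vector depend on the base point. -/
noncomputable def coeffForm : Point n →L[ℝ] Point n →L[ℝ] ℝ :=
  ∑ i : Fin n,
    (((ContinuousLinearMap.proj i).comp ((ContinuousLinearMap.fst ℝ (Fin n → ℝ) ℝ).comp
        (ContinuousLinearMap.snd ℝ (Fin n → ℝ) ((Fin n → ℝ) × ℝ)))).smulRight
      ((ContinuousLinearMap.proj (R := ℝ) (φ := fun _ : Fin n => ℝ) i).comp
        (ContinuousLinearMap.fst ℝ (Fin n → ℝ) ((Fin n → ℝ) × ℝ))) -
    ((ContinuousLinearMap.proj i).comp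
        (ContinuousLinearMap.fst ℝ (Fin n → ℝ) ((Fin n → ℝ) × ℝ))).smulRight
      ((ContinuousLinearMap.proj (R := ℝ) (φ := fun _ : Fin n => ℝ) i).comp
        ((ContinuousLinearMap.fst ℝ (Fin n → ℝ) ℝ).comp
          (ContinuousLinearMap.snd ℝ (Fin n → ℝ) ((Fin n → ℝ) × ℝ)))))

theorem coeffForm_apply (q w : Point n) :
    coeffForm q w = ∑ i, (q.2.1 i * w.1 i - q.1 i * w.2.1 i) := by
  simp [coeffForm]

/-- The coefficients at the origin, as a continuous linear map. -/
noncomputable def coeffZero : Point n →L[ℝ] Vec n := LinearMap.toContinuousLinearMap (coeff 0)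

/-- Only the `T`-coefficient depends on the base point, and it does so bilinearly, so coefficients
along the hypersurface can be differentiated by the product rule. -/
theorem coeff_eq (q w : Point n) : coeff q w = coeffZero w - coeffForm q w • T := by
  rw [coeffForm_apply]
  ext j
  rcases j with (i | i) | i <;> simp [coeff, coeffZero, T]

/-- Identifies the base-point dependence of the coefficients with the form `⟨J ·, ·⟩`, the origin of
the torsion. -/
theorem inner_J_coeff (q v w : Point n) :
    inner ℝ (J (coeff q v)) (coeff q w) = -coeffForm v w := by
  rw [coeffForm_apply]
  simp [PiLp.inner_apply, J, coeff, Finset.sum_sub_distrib, mul_comm]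
  ring

theorem coeffForm_antisymm (v w : Point n) : coeffForm v w = -coeffForm w v := by
  simp only [coeffForm_apply, ← Finset.sum_neg_distrib]
  exact Finset.sum_congr rfl fun i _ => by ring

theorem coeff_injective (q : Point n) : Function.Injective (coeff q) := fun v w h => by
  rw [← sum_coeff_smul_Z q v, h, sum_coeff_smul_Z]

end Ambient

/-! ### The horizontal normal `ν` and the function `α`. -/

section HorizontalNormal

variable {n : ℕ} {M : Type*} {N : M → Vec n}

theorem inner_horNormal_T (N : M → Vec n) (p : M) : inner ℝ (horNormal N p) T = 0 := by
  rw [horNormal, inner_sub_left, real_inner_smul_left, inner_T_T]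
  ring

theorem inner_nu_T (N : M → Vec n) (p : M) : inner ℝ (nu N p) T = 0 := by
  rw [nu, real_inner_smul_left, inner_horNormal_T, mul_zero]

theorem inner_nu_nu {p : M} (h : horNormal N p ≠ 0) : inner ℝ (nu N p) (nu N p) = 1 := by
  rw [real_inner_self_eq_norm_sq, nu, norm_smul, norm_inv, norm_norm,
    inv_mul_cancel₀ (norm_ne_zero_iff.2 h), one_pow]

/-- `N` is a multiple of `ν + α T`. -/
theorem nu_add_alpha_T (N : M → Vec n) {p : M} :
    nu N p + alpha N p • T = ‖horNormal N p‖⁻¹ • N p := by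
  have h1 : N p = horNormal N p + inner ℝ (N p) T • T := by
    rw [horNormal, sub_add_cancel]
  conv_rhs => rw [h1]
  rw [nu, alpha, smul_add, smul_smul, div_eq_inv_mul]

theorem inner_J_nu_nu (N : M → Vec n) (p : M) : inner ℝ (J (nu N p)) (nu N p) = 0 := by
  have := inner_J_left (nu N p) (nu N p)
  rw [real_inner_comm (J (nu N p))] at this
  linarith

end HorizontalNormal

/-! ### Tangent spaces, torsion and the structure equation. -/

section Pushforward

variable {n : ℕ} {M : Type*} [TopologicalSpace M] [ChartedSpace (EuclideanSpace ℝ (Fin (2 * n))) M]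
  {φ : M → Point n} {U : Set M} {N : M → Vec n}

theorem push_injective (hφ : IsImmersedHypersurface φ) (p : M) : Function.Injective (push φ p) :=
  (coeff_injective (φ p)).comp (hφ.injective p)

theorem lift_push (hφ : IsImmersedHypersurface φ) (p : M) (X : TS n p) :
    lift φ p (push φ p X) = X :=
  Function.leftInverse_invFun (push_injective hφ p) X

theorem finrank_range_push (hφ : IsImmersedHypersurface φ) (p : M) :
    Module.finrank ℝ (LinearMap.range (push φ p)) = 2 * n := by
  rw [LinearMap.finrank_range_of_inj (push_injective hφ p)]
  exact finrank_euclideanSpace_fin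

/-- A hyperplane containing `T_p S` equals `T_p S`. -/
theorem exists_push_eq (hφ : IsImmersedHypersurface φ) {p : M} {v : Vec n} (hv : v ≠ 0)
    (h : ∀ X, inner ℝ v (push φ p X) = 0) {w : Vec n} (hw : inner ℝ v w = 0) :
    ∃ X, push φ p X = w := by
  have h1 : LinearMap.range (push φ p) ≤ (Submodule.span ℝ {v})ᗮ := by
    rintro _ ⟨X, rfl⟩
    exact Submodule.mem_orthogonal_singleton_iff_inner_right.2 (h X)
  have h2 : Module.finrank ℝ ((Submodule.span ℝ {v})ᗮ : Submodule ℝ (Vec n)) = 2 * n := by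
    have : Fact (Module.finrank ℝ (Vec n) = 2 * n + 1) := ⟨finrank_vec⟩
    exact Submodule.finrank_orthogonal_span_singleton hv
  have h3 := Submodule.eq_of_le_of_finrank_eq h1 ((finrank_range_push hφ p).trans h2.symm)
  have h4 : w ∈ LinearMap.range (push φ p) := by
    rw [h3]
    exact Submodule.mem_orthogonal_singleton_iff_inner_right.2 hw
  exact h4

theorem IsUnitNormal.ne_zero (hN : IsUnitNormal φ U N) {p : M} (hp : p ∈ U) : N p ≠ 0 := by
  have := hN.unit p hp
  intro h
  rw [h, norm_zero] at this
  exact zero_ne_one this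

/-- If the horizontal part of `N` vanished, `N` would be a nonzero multiple of `T`, and the
hyperplane `T_p S` would be `𝓗_p`. -/
theorem horNormal_ne_zero (hφ : IsImmersedHypersurface φ) (hN : IsUnitNormal φ U N) {p : M}
    (hp : p ∈ U) (hc : ¬ IsCharacteristic φ p) : horNormal N p ≠ 0 := by
  intro h
  apply hc
  have hNT : N p = inner ℝ (N p) T • T := sub_eq_zero.1 h
  have hne : inner ℝ (N p) T ≠ 0 := fun h0 => hN.ne_zero hp (by rw [hNT, h0, zero_smul])
  have hT : ∀ w : Vec n, inner ℝ (N p) w = inner ℝ (N p) T * inner ℝ w T := fun w => by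
    conv_lhs => rw [hNT, real_inner_smul_left, real_inner_comm w T]
  ext w
  rw [mem_horizontal]
  constructor
  · rintro ⟨X, rfl⟩
    have := hN.normal p hp X
    rw [hT] at this
    exact (mul_eq_zero.1 this).resolve_left hne
  · intro hw
    exact exists_push_eq hφ (hN.ne_zero hp) (hN.normal p hp) (by rw [hT, hw, mul_zero])

theorem inner_nu_push (hN : IsUnitNormal φ U N) {p : M} (hp : p ∈ U) (X : TS n p) :
    inner ℝ (nu N p) (push φ p X) + alpha N p * inner ℝ T (push φ p X) = 0 := by
  have h : inner ℝ (nu N p + alpha N p • T) (push φ p X) = 0 := by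
    rw [nu_add_alpha_T, real_inner_smul_left, hN.normal p hp, mul_zero]
  rwa [inner_add_left, real_inner_smul_left] at h

theorem exists_push_eq_of_inner (hφ : IsImmersedHypersurface φ) (hN : IsUnitNormal φ U N) {p : M}
    (hp : p ∈ U) {w : Vec n}
    (hw : inner ℝ (nu N p) w + alpha N p * inner ℝ T w = 0) (hc : horNormal N p ≠ 0) :
    ∃ X, push φ p X = w := by
  refine exists_push_eq hφ (hN.ne_zero hp) (hN.normal p hp) ?_
  have h : inner ℝ (nu N p + alpha N p • T) w = 0 := by
    rw [inner_add_left, real_inner_smul_left, hw]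
  rw [nu_add_alpha_T, real_inner_smul_left] at h
  exact (mul_eq_zero.1 h).resolve_left (inv_ne_zero (norm_ne_zero_iff.2 hc))

theorem smoothOn_inner_T {f : M → Vec n} (hf : SmoothOn n f U) :
    SmoothOn n (fun q => inner ℝ (f q) T) U :=
  (((innerSL ℝ (T : Vec n)).contDiff.contMDiff.comp_contMDiffOn hf).congr fun _ _ => real_inner_comm _ _)

theorem smoothOn_horNormal (hN : IsUnitNormal φ U N) : SmoothOn n (horNormal N) U :=
  hN.smooth.sub ((smoothOn_inner_T hN.smooth).smul contMDiffOn_const)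

theorem smoothOn_inv_norm_horNormal (hN : IsUnitNormal φ U N) (h : ∀ q ∈ U, horNormal N q ≠ 0) :
    SmoothOn n (fun q => ‖horNormal N q‖⁻¹) U := fun q hq => by
  have h1 : ContDiffAt ℝ ∞ (fun v : Vec n => ‖v‖⁻¹) (horNormal N q) :=
    (contDiffAt_norm ℝ (h q hq)).inv (norm_ne_zero_iff.2 (h q hq))
  exact h1.comp_contMDiffWithinAt (smoothOn_horNormal hN q hq)

theorem smoothOn_nu (hN : IsUnitNormal φ U N) (h : ∀ q ∈ U, horNormal N q ≠ 0) :
    SmoothOn n (nu N) U :=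
  (smoothOn_inv_norm_horNormal hN h).smul (smoothOn_horNormal hN)

theorem smoothOn_alpha (hN : IsUnitNormal φ U N) (h : ∀ q ∈ U, horNormal N q ≠ 0) :
    SmoothOn n (alpha N) U := by
  have := (smoothOn_inner_T hN.smooth).smul (smoothOn_inv_norm_horNormal hN h)
  exact this.congr fun _ _ => by simp [alpha, div_eq_mul_inv]

theorem IsImmersedHypersurface.smoothOn (hφ : IsImmersedHypersurface φ) (U : Set M) :
    SmoothOn n φ U := hφ.smooth.contMDiffOn

theorem push_eq (p : M) (X : TS n p) :
    push φ p X = coeffZero (dir φ p X) - coeffForm (φ p) (dir φ p X) • T := coeff_eq _ _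

variable [IsManifold (𝓡 (2 * n)) ∞ M]

/-- The second term comes from differentiating the base point in `coeff_eq`; the first is symmetric
up to the bracket, so antisymmetrizing isolates the torsion. -/
theorem dir_push_eq (hφ : IsImmersedHypersurface φ) {p : M} {Y : ∀ q : M, TS n q}
    (hY : DiffAt n (fun q => dir (chartMap n p) q (Y q)) p) :
    DiffAt n (fun q => push φ q (Y q)) p ∧ ∀ X : TS n p, dir (fun q => push φ q (Y q)) p X =
      coeff (φ p) (dir (fun q => dir φ q (Y q)) p X) -
        coeffForm (dir φ p X) (dir φ p (Y p)) • T := by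
  have h0 : DiffAt n φ p := (hφ.smoothOn Set.univ).diffAt isOpen_univ (Set.mem_univ p)
  have h1 := diffAt_dir (hφ.smoothOn Set.univ) isOpen_univ (Set.mem_univ p) hY
  have h2 := DiffAt.clm (coeffZero (n := n)) h1
  have h3 := DiffAt.bilin (coeffForm (n := n)) h0 h1
  let L : ℝ →L[ℝ] Vec n := (ContinuousLinearMap.id ℝ ℝ).smulRight (-T)
  have h4 := DiffAt.clm L h3
  have e : (fun q => push φ q (Y q)) = fun q => coeffZero (dir φ q (Y q)) +
      L (coeffForm (φ q) (dir φ q (Y q))) := by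
    ext1 q
    simp [push_eq, L, sub_eq_add_neg]
  rw [e]
  refine ⟨h2.add h4, fun X => ?_⟩
  rw [dir_add h2 h4, dir_clm L h3, dir_clm coeffZero h1, dir_bilin coeffForm h0 h1, coeff_eq]
  simp only [L, ContinuousLinearMap.smulRight_apply, ContinuousLinearMap.id_apply, add_smul,
    smul_neg]
  abel

/-- The torsion of the pseudohermitian connection, along the hypersurface. -/
theorem dir_push_sub (hφ : IsImmersedHypersurface φ) {p : M} {X Y : ∀ q : M, TS n q}
    (hX : DiffAt n (fun q => dir (chartMap n p) q (X q)) p)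
    (hY : DiffAt n (fun q => dir (chartMap n p) q (Y q)) p) :
    ∃ Z : TS n p, (∀ (F : Type) [NormedAddCommGroup F] [NormedSpace ℝ F] (f : M → F) (U : Set M),
      IsOpen U → p ∈ U → SmoothOn n f U →
      dir (fun q => dir f q (Y q)) p (X p) - dir (fun q => dir f q (X q)) p (Y p) = dir f p Z) ∧
      dir (fun q => push φ q (Y q)) p (X p) - dir (fun q => push φ q (X q)) p (Y p) =
        push φ p Z + (2 * inner ℝ (J (push φ p (X p))) (push φ p (Y p))) • T := by
  obtain ⟨Z, hZ⟩ := exists_bracket hX hY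
  refine ⟨Z, hZ, ?_⟩
  have h1 := hZ (Point n) φ Set.univ isOpen_univ (Set.mem_univ p) (hφ.smoothOn _)
  rw [(dir_push_eq hφ hY).2, (dir_push_eq hφ hX).2]
  change _ = coeff (φ p) (dir φ p Z) +
    (2 * inner ℝ (J (coeff (φ p) (dir φ p (X p)))) (coeff (φ p) (dir φ p (Y p)))) • T
  rw [← h1, map_sub, inner_J_coeff, coeffForm_antisymm (dir φ p (Y p))]
  module

/-- The structure equation: the one-form `⟨ν + α T, ·⟩` vanishes on the hypersurface. -/
theorem structure_equation (hφ : IsImmersedHypersurface φ) (hU : IsOpen U)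
    (hN : IsUnitNormal φ U N) (hc : ∀ q ∈ U, horNormal N q ≠ 0) {p : M} (hp : p ∈ U)
    (v w : TS n p) :
    inner ℝ (dir (nu N) p v) (push φ p w) - inner ℝ (dir (nu N) p w) (push φ p v) +
      dir (alpha N) p v * inner ℝ T (push φ p w) - dir (alpha N) p w * inner ℝ T (push φ p v) +
      2 * alpha N p * inner ℝ (J (push φ p v)) (push φ p w) = 0 := by
  obtain ⟨X, rfl, hX⟩ := exists_extension (n := n) v
  obtain ⟨Y, rfl, hY⟩ := exists_extension (n := n) w
  obtain ⟨Z, -, hZ⟩ := dir_push_sub hφ hX hY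
  have hν := (smoothOn_nu hN hc).diffAt hU hp
  have hα := (smoothOn_alpha hN hc).diffAt hU hp
  -- The derivative along `u` of the identity `⟨ν + α T, V⟩ = 0`. Antisymmetrizing leaves the
  -- bracket, which is tangent and drops out, and the torsion, which enters through `α`.
  have key : ∀ (V : ∀ q : M, TS n q), DiffAt n (fun q => dir (chartMap n p) q (V q)) p →
      ∀ u : TS n p, inner ℝ (dir (nu N) p u) (push φ p (V p)) +
        inner ℝ (nu N p) (dir (fun q => push φ q (V q)) p u) +
        dir (alpha N) p u * inner ℝ T (push φ p (V p)) +
        alpha N p * inner ℝ T (dir (fun q => push φ q (V q)) p u) = 0 := by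
    intro V hV u
    have hd := (dir_push_eq hφ hV).1
    have hT : DiffAt n (fun _ : M => (T : Vec n)) p := mdifferentiableAt_const
    have h1 : dir (fun q => inner ℝ (nu N q) (push φ q (V q)) +
        alpha N q * inner ℝ T (push φ q (V q))) p u = 0 := by
      rw [dir_congr hU hp (g := fun _ => (0 : ℝ)) fun q hq => inner_nu_push hN hq (V q)]
      exact dir_const _ _ _
    rw [dir_add (hν.inner hd) (hα.mul (hT.inner hd)), dir_mul hα (hT.inner hd),
      dir_inner hν hd, dir_inner hT hd, dir_const, inner_zero_left] at h1
    linarith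
  have h1 := key Y hY (X p)
  have h2 := key X hX (Y p)
  have h3 := inner_nu_push hN hp Z
  have h4 : inner ℝ (nu N p) (dir (fun q => push φ q (Y q)) p (X p)) -
      inner ℝ (nu N p) (dir (fun q => push φ q (X q)) p (Y p)) =
      inner ℝ (nu N p) (push φ p Z) := by
    rw [← inner_sub_right, hZ, inner_add_right, inner_smul_right, inner_nu_T]
    ring
  have h5 : inner ℝ T (dir (fun q => push φ q (Y q)) p (X p)) -
      inner ℝ T (dir (fun q => push φ q (X q)) p (Y p)) =
      inner ℝ T (push φ p Z) + 2 * inner ℝ (J (push φ p (X p))) (push φ p (Y p)) := by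
    rw [← inner_sub_right, hZ, inner_add_right, inner_smul_right, inner_T_T]
    ring
  linear_combination h1 - h2 - h3 - h4 - alpha N p * h5

end Pushforward

end Heisenberg

namespace Heisenberg

/-! ### Components in an orthonormal frame of `𝓗 TS`. -/

section Frame

variable {n : ℕ} {M : Type*} [TopologicalSpace M] [ChartedSpace (EuclideanSpace ℝ (Fin (2 * n))) M]

/-- The frame vector `E_j` as a vector field of `ℍⁿ` along the hypersurface. -/
noncomputable def frameVec (φ : M → Point n) (E : Fin (2 * n - 1) → ∀ q : M, TS n q) (j : Fin (2 * n - 1))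
    (q : M) : Vec n := push φ q (E j q)

/-- The connection coefficients `⟨∇_{E_i} E_j, E_k⟩`. -/
noncomputable def christoffel (φ : M → Point n) (E : Fin (2 * n - 1) → ∀ q : M, TS n q) (q : M)
    (i j k : Fin (2 * n - 1)) : ℝ := inner ℝ (dir (frameVec φ E j) q (E i q)) (frameVec φ E k q)

/-- The components of `h`. -/
noncomputable def hComp (φ : M → Point n) (N : M → Vec n) (E : Fin (2 * n - 1) → ∀ q : M, TS n q) (q : M)
    (i j : Fin (2 * n - 1)) : ℝ := inner ℝ (dir (nu N) q (E i q)) (frameVec φ E j q)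

/-- The components of `h̃`. -/
noncomputable def hSymmComp (φ : M → Point n) (N : M → Vec n) (E : Fin (2 * n - 1) → ∀ q : M, TS n q) (q : M)
    (i j : Fin (2 * n - 1)) : ℝ := hSymm φ N q (E i q) (E j q)

/-- The components of the complex structure. -/
noncomputable def jComp (φ : M → Point n) (E : Fin (2 * n - 1) → ∀ q : M, TS n q) (q : M)
    (i j : Fin (2 * n - 1)) : ℝ := inner ℝ (J (frameVec φ E i q)) (frameVec φ E j q)

/-- The components of `J(ν)`. -/
noncomputable def jnuComp (φ : M → Point n) (N : M → Vec n) (E : Fin (2 * n - 1) → ∀ q : M, TS n q) (q : M)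
    (j : Fin (2 * n - 1)) : ℝ := inner ℝ (J (nu N q)) (frameVec φ E j q)

/-- The components of `∇^S h̃`. -/
noncomputable def nablaComp (φ : M → Point n) (N : M → Vec n) (E : Fin (2 * n - 1) → ∀ q : M, TS n q) (q : M)
    (i j k : Fin (2 * n - 1)) : ℝ := nablaTensor φ N (hSymm φ N) q (E i q) (E j) (E k)

variable {φ : M → Point n} {U : Set M} {N : M → Vec n} {E : Fin (2 * n - 1) → ∀ q : M, TS n q}
  {p : M}

theorem inner_J_frame_nu (j) :
    inner ℝ (J (frameVec φ E j p)) (nu N p) = -jnuComp φ N E p j := by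
  rw [inner_J_left, real_inner_comm, jnuComp]

theorem jComp_antisymm (i j) : jComp φ E p i j = -jComp φ E p j i := by
  rw [jComp, inner_J_left, real_inner_comm, jComp]

theorem hSymm_sum_right (c : Fin (2 * n - 1) → ℝ) (j) :
    hSymm φ N p (E j p) (∑ l, c l • E l p) = ∑ l, c l * hSymmComp φ N E p j l := by
  simp only [hSymmComp, hSymm, map_sum, map_smul, inner_sum, inner_smul_right]

variable [IsManifold (𝓡 (2 * n)) ∞ M]

section Pointwise

variable (hφ : IsImmersedHypersurface φ) (hL : IsLocalFrame φ U N E) (hp : p ∈ U)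
include hφ hL

theorem IsLocalFrame.horNormal_ne : ∀ q ∈ U, horNormal N q ≠ 0 := fun q hq =>
  horNormal_ne_zero hφ hL.normal hq (hL.nonchar q hq)

include hp

theorem IsLocalFrame.nu_nu : inner ℝ (nu N p) (nu N p) = 1 :=
  inner_nu_nu (hL.horNormal_ne hφ p hp)

omit hφ in
theorem IsLocalFrame.frame_T (j) : inner ℝ (frameVec φ E j p) T = 0 :=
  mem_horizontal.1 (hL.frame.horizontal p hp j)

omit hφ in
theorem IsLocalFrame.nu_frame (j) : inner ℝ (nu N p) (frameVec φ E j p) = 0 := by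
  have h1 := inner_nu_push hL.normal hp (E j p)
  have h2 := hL.frame_T hp j
  rw [real_inner_comm] at h2
  rw [frameVec] at h2 ⊢
  rw [h2] at h1
  linarith

omit hφ in
theorem IsLocalFrame.frame_frame (i j) :
    inner ℝ (frameVec φ E i p) (frameVec φ E j p) = idm i j := by
  have := orthonormal_iff_ite.1 (hL.frame.orthonormal p hp) i j
  rw [idm]
  exact this

/-- The frame together with `ν` and `T` is orthonormal in dimension `2n + 1`. The hypothesis `0 < n`
makes the truncated `2 * n - 1` the true count. -/
theorem IsLocalFrame.expand (hn : 0 < n) (w : Vec n) :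
    w = (∑ k, inner ℝ w (frameVec φ E k p) • frameVec φ E k p) +
      inner ℝ w (nu N p) • nu N p + inner ℝ w T • T := by
  have hon : Orthonormal ℝ (Sum.elim (fun k => frameVec φ E k p) ![nu N p, T] :
      Fin (2 * n - 1) ⊕ Fin 2 → Vec n) := by
    rw [orthonormal_iff_ite]
    have h1 := hL.nu_nu hφ hp
    have h2 := hL.nu_frame hp
    have h3 := hL.frame_T hp
    have h4 := hL.frame_frame hp
    have h5 := inner_nu_T N p
    have h6 := inner_T_T (n := n)
    have h2' : ∀ j, inner ℝ (frameVec φ E j p) (nu N p) = 0 := fun j => by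
      rw [real_inner_comm, h2]
    have h3' : ∀ j, inner ℝ T (frameVec φ E j p) = 0 := fun j => by
      rw [real_inner_comm, h3]
    have h5' : inner ℝ T (nu N p) = 0 := by rw [real_inner_comm, h5]
    have h1' : ‖nu N p‖ = 1 := by
      rw [real_inner_self_eq_norm_sq] at h1
      exact (pow_eq_one_iff_of_nonneg (norm_nonneg _) two_ne_zero).1 h1
    have h6' : ‖(T : Vec n)‖ = 1 := by
      rw [real_inner_self_eq_norm_sq] at h6
      exact (pow_eq_one_iff_of_nonneg (norm_nonneg _) two_ne_zero).1 h6
    rintro (i | i) (j | j)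
    · simp [h4, idm]
    · fin_cases j <;> simp [h2', h3]
    · fin_cases i <;> simp [h2, h3']
    · fin_cases i <;> fin_cases j <;> simp [h1', h5, h5', h6']
  have hcard : Fintype.card (Fin (2 * n - 1) ⊕ Fin 2) = Module.finrank ℝ (Vec n) := by
    rw [finrank_vec]
    simp
    omega
  let b := (basisOfOrthonormalOfCardEqFinrank hon hcard).toOrthonormalBasis (by simpa using hon)
  have hb : ∀ i, b i = Sum.elim (fun k => frameVec φ E k p) ![nu N p, T] i := fun i => by
    simp [b]
  have h := b.sum_repr' w
  simp only [hb, Fintype.sum_sum_type, Sum.elim_inl, Sum.elim_inr, Fin.sum_univ_two,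
    Matrix.cons_val_zero, Matrix.cons_val_one] at h
  conv_lhs => rw [← h]
  simp only [real_inner_comm w]
  abel

theorem IsLocalFrame.parseval (hn : 0 < n) (v w : Vec n) :
    inner ℝ v w = (∑ k, inner ℝ v (frameVec φ E k p) * inner ℝ w (frameVec φ E k p)) +
      inner ℝ v (nu N p) * inner ℝ w (nu N p) + inner ℝ v T * inner ℝ w T := by
  conv_lhs => rw [hL.expand hφ hp hn w]
  simp only [inner_add_right, inner_sum, inner_smul_right, mul_comm]

theorem IsLocalFrame.nu_diffAt : DiffAt n (nu N) p :=
  (smoothOn_nu hL.normal (hL.horNormal_ne hφ)).diffAt hL.isOpen hp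

theorem IsLocalFrame.alpha_diffAt : DiffAt n (alpha N) p :=
  (smoothOn_alpha hL.normal (hL.horNormal_ne hφ)).diffAt hL.isOpen hp

omit hφ in
theorem IsLocalFrame.coordinates_diffAt (j) :
    DiffAt n (fun q => dir (chartMap n p) q (E j q)) p :=
  diffAt_coordinates hL.isOpen hp (hL.frame.smooth j)

theorem IsLocalFrame.frame_diffAt (j) : DiffAt n (frameVec φ E j) p :=
  (dir_push_eq hφ (hL.coordinates_diffAt hp j)).1

theorem IsLocalFrame.dir_nu_diffAt (j) : DiffAt n (fun q => dir (nu N) q (E j q)) p :=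
  diffAt_dir (smoothOn_nu hL.normal (hL.horNormal_ne hφ)) hL.isOpen hp
    (hL.coordinates_diffAt hp j)

theorem IsLocalFrame.dir_nu_T (X : TS n p) : inner ℝ (dir (nu N) p X) T = 0 := by
  have hT : DiffAt n (fun _ : M => (T : Vec n)) p := mdifferentiableAt_const
  have h := dir_inner (hL.nu_diffAt hφ hp) hT X
  rw [dir_congr hL.isOpen hp (g := fun _ => (0 : ℝ)) fun q _ => inner_nu_T N q, dir_const,
    dir_const, inner_zero_right, add_zero] at h
  exact h.symm

theorem IsLocalFrame.dir_nu_nu (X : TS n p) : inner ℝ (dir (nu N) p X) (nu N p) = 0 := by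
  have h := dir_inner (hL.nu_diffAt hφ hp) (hL.nu_diffAt hφ hp) X
  rw [dir_congr hL.isOpen hp (g := fun _ => (1 : ℝ)) fun q hq => hL.nu_nu hφ hq, dir_const,
    real_inner_comm (dir (nu N) p X)] at h
  linarith

theorem IsLocalFrame.dir_frame_T (j) (X : TS n p) :
    inner ℝ (dir (frameVec φ E j) p X) T = 0 := by
  have hT : DiffAt n (fun _ : M => (T : Vec n)) p := mdifferentiableAt_const
  have h := dir_inner (hL.frame_diffAt hφ hp j) hT X
  rw [dir_congr hL.isOpen hp (g := fun _ => (0 : ℝ)) fun q hq => hL.frame_T hq j, dir_const,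
    dir_const, inner_zero_right, add_zero] at h
  exact h.symm

theorem IsLocalFrame.dir_frame_nu (j) (X : TS n p) :
    inner ℝ (dir (frameVec φ E j) p X) (nu N p) =
      -inner ℝ (dir (nu N) p X) (frameVec φ E j p) := by
  have h := dir_inner (hL.nu_diffAt hφ hp) (hL.frame_diffAt hφ hp j) X
  rw [dir_congr hL.isOpen hp (g := fun _ => (0 : ℝ)) fun q hq => hL.nu_frame hq j, dir_const,
    real_inner_comm (dir (frameVec φ E j) p X)] at h
  linarith

theorem IsLocalFrame.christoffel_antisymm (i j k) :
    christoffel φ E p i j k = -christoffel φ E p i k j := by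
  have h := dir_inner (hL.frame_diffAt hφ hp j) (hL.frame_diffAt hφ hp k) (E i p)
  rw [dir_congr hL.isOpen hp (g := fun _ => idm j k) fun q hq => hL.frame_frame hq j k, dir_const,
    real_inner_comm (dir (frameVec φ E k) p (E i p))] at h
  rw [christoffel, christoffel]
  linarith

/-! ### Algebraic relations between the components -/

/-- `J` is isometric on `𝓗`, and the component of `J(E_i)` along `ν`, lost in the compression, is
`-⟨J(ν), E_i⟩`. -/
theorem IsLocalFrame.jComp_sq (hn : 0 < n) (i j) :
    ∑ s, jComp φ E p i s * jComp φ E p j s =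
      idm i j - jnuComp φ N E p i * jnuComp φ N E p j := by
  have h := hL.parseval hφ hp hn (J (frameVec φ E i p)) (J (frameVec φ E j p))
  rw [inner_J_J, hL.frame_T hp, inner_J_frame_nu, inner_J_frame_nu, inner_J_T,
    hL.frame_frame hp] at h
  simp only [jComp]
  linarith

theorem IsLocalFrame.jComp_jnuComp (hn : 0 < n) (i) :
    ∑ s, jComp φ E p i s * jnuComp φ N E p s = 0 := by
  have h := hL.parseval hφ hp hn (J (frameVec φ E i p)) (J (nu N p))
  rw [inner_J_J, hL.frame_T hp, inner_J_nu_nu, inner_J_T, real_inner_comm, hL.nu_frame hp] at h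
  simp only [jComp, jnuComp]
  linarith

theorem IsLocalFrame.jnuComp_sq (hn : 0 < n) :
    ∑ s, jnuComp φ N E p s * jnuComp φ N E p s = 1 := by
  have h := hL.parseval hφ hp hn (J (nu N p)) (J (nu N p))
  rw [inner_J_J, inner_nu_T, inner_J_nu_nu, inner_J_T, hL.nu_nu hφ hp] at h
  simp only [jnuComp]
  linarith

theorem IsLocalFrame.Jnu_eq (hn : 0 < n) :
    Jnu φ N p = ∑ k, jnuComp φ N E p k • E k p := by
  have h := hL.expand hφ hp hn (J (nu N p))
  rw [inner_J_nu_nu, inner_J_T, zero_smul, zero_smul, add_zero, add_zero] at h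
  have h2 : push φ p (∑ k, jnuComp φ N E p k • E k p) = J (nu N p) := by
    rw [map_sum]
    refine Eq.trans ?_ h.symm
    exact Finset.sum_congr rfl fun k _ => by rw [map_smul]; rfl
  rw [Jnu, ← h2, lift_push hφ]

omit hφ in
-- `J'(v)` and `J(v)` differ by a multiple of `ν`, because `J(J(ν)) = -ν`, and the frame is
-- orthogonal to `ν`.
theorem IsLocalFrame.hSymm_eq (X : TS n p) (k) : hSymm φ N p X (E k p) =
    inner ℝ (dir (nu N) p X) (frameVec φ E k p) +
      alpha N p * inner ℝ (J (push φ p X)) (frameVec φ E k p) := by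
  rw [hSymm, shapeSymm, inner_add_left, real_inner_smul_left, J', map_sub, map_smul, J_J,
    inner_nu_T, inner_sub_left, real_inner_smul_left]
  have h := hL.nu_frame hp k
  rw [frameVec] at h ⊢
  rw [zero_smul, add_zero, inner_neg_left, h]
  rw [shape, cov]
  ring

omit hφ in
theorem IsLocalFrame.hSymmComp_eq (j k) :
    hSymmComp φ N E p j k = hComp φ N E p j k + alpha N p * jComp φ E p j k :=
  hL.hSymm_eq hp _ _

omit hφ in
theorem IsLocalFrame.hSymm_sum (c : Fin (2 * n - 1) → ℝ) (k) :
    hSymm φ N p (∑ l, c l • E l p) (E k p) = ∑ l, c l * hSymmComp φ N E p l k := by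
  rw [hL.hSymm_eq hp]
  simp only [hSymmComp, hL.hSymm_eq hp, dir_sum_vec, dir_smul_vec, map_sum, map_smul, sum_inner,
    real_inner_smul_left, Finset.mul_sum, ← Finset.sum_add_distrib]
  exact Finset.sum_congr rfl fun _ _ => by ring

/-- On horizontal vectors the `dα` terms of the structure equation vanish; the correction `α J'` in
`h̃` removes precisely this antisymmetric part. -/
theorem IsLocalFrame.hComp_sub (i j) :
    hComp φ N E p i j - hComp φ N E p j i = -(2 * alpha N p * jComp φ E p i j) := by
  have h := structure_equation hφ hL.isOpen hL.normal (hL.horNormal_ne hφ) hp (E i p) (E j p)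
  have hi : inner ℝ T (push φ p (E i p)) = 0 := by
    rw [real_inner_comm]
    exact hL.frame_T hp i
  have hj : inner ℝ T (push φ p (E j p)) = 0 := by
    rw [real_inner_comm]
    exact hL.frame_T hp j
  rw [hi, hj] at h
  simp only [hComp, jComp, frameVec]
  linarith

theorem IsLocalFrame.hSymmComp_symm (i j) : hSymmComp φ N E p i j = hSymmComp φ N E p j i := by
  have h := hL.hComp_sub hφ hp i j
  rw [hL.hSymmComp_eq hp, hL.hSymmComp_eq hp, jComp_antisymm j i]
  linarith

theorem IsLocalFrame.nablaS_eq (hn : 0 < n) (i j) :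
    nablaS φ N p (E i p) (E j) = ∑ k, christoffel φ E p i j k • E k p := by
  have h := hL.expand hφ hp hn (dir (frameVec φ E j) p (E i p))
  rw [hL.dir_frame_T hφ hp, zero_smul, add_zero] at h
  have h2 : push φ p (∑ k, christoffel φ E p i j k • E k p) = dir (frameVec φ E j) p (E i p) -
      inner ℝ (dir (frameVec φ E j) p (E i p)) (nu N p) • nu N p := by
    rw [eq_sub_iff_add_eq, map_sum]
    refine Eq.trans ?_ h.symm
    congr 1
    exact Finset.sum_congr rfl fun k _ => by rw [map_smul]; rfl
  rw [← lift_push hφ p (∑ k, christoffel φ E p i j k • E k p), h2]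
  rfl

theorem IsLocalFrame.hSymmComp_diffAt (j k) : DiffAt n (fun q => hSymmComp φ N E q j k) p := by
  have h1 := (hL.dir_nu_diffAt hφ hp j).inner (hL.frame_diffAt hφ hp k)
  have h2 := ((hL.frame_diffAt hφ hp j).clm JL).inner (hL.frame_diffAt hφ hp k)
  exact (h1.add ((hL.alpha_diffAt hφ hp).mul h2)).congr_of_eventuallyEq
    (Filter.eventually_of_mem (hL.isOpen.mem_nhds hp) fun q hq => hL.hSymmComp_eq hq j k)

theorem IsLocalFrame.nablaComp_eq (hn : 0 < n) (i j k) : nablaComp φ N E p i j k =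
    dir (fun q => hSymmComp φ N E q j k) p (E i p) -
      (∑ l, christoffel φ E p i j l * hSymmComp φ N E p l k) -
      ∑ l, christoffel φ E p i k l * hSymmComp φ N E p j l := by
  rw [nablaComp, nablaTensor, hL.nablaS_eq hφ hp hn, hL.nablaS_eq hφ hp hn, hL.hSymm_sum hp,
    hSymm_sum_right]
  rfl

end Pointwise

end Frame

end Heisenberg

namespace Heisenberg

/-! ### The Codazzi equation, minimality, (P1), (P2) and the inequalities. -/

section Codazzi

variable {n : ℕ} {M : Type*} [TopologicalSpace M] [ChartedSpace (EuclideanSpace ℝ (Fin (2 * n))) M]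
  [IsManifold (𝓡 (2 * n)) ∞ M] {φ : M → Point n} {U : Set M} {N : M → Vec n}
  {E : Fin (2 * n - 1) → ∀ q : M, TS n q} {p : M}

variable (hφ : IsImmersedHypersurface φ) (hL : IsLocalFrame φ U N E) (hp : p ∈ U)
include hφ hL hp

omit hφ in
theorem IsLocalFrame.normSqGradHS_eq (f : M → ℝ) :
    normSqGradHS φ E f p = ∑ i, dir f p (E i p) * dir f p (E i p) := by
  have h := (hL.frame.orthonormal p hp).inner_sum (fun j => dir f p (E j p))
    (fun j => dir f p (E j p)) Finset.univ
  rw [normSqGradHS, gradHS, ← real_inner_self_eq_norm_sq, map_sum]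
  simp only [map_smul]
  exact h

/-- The connection terms pair the symmetric matrix `B²` with antisymmetric connection coefficients,
so the plain derivative may be replaced by the covariant one. -/
theorem IsLocalFrame.dir_normSqHSymm (hn : 0 < n) (i) :
    dir (normSqHSymm φ N E) p (E i p) = 2 * ip2 (hSymmComp φ N E p) (nablaComp φ N E p i) := by
  have hd := fun j k => hL.hSymmComp_diffAt hφ hp j k
  have e : normSqHSymm φ N E = fun q => ∑ j, ∑ k, hSymmComp φ N E q j k * hSymmComp φ N E q j k := by
    ext q
    simp only [normSqHSymm, hSymmComp, sq]
  have hdir : dir (normSqHSymm φ N E) p (E i p) = ∑ j, ∑ k, 2 * (hSymmComp φ N E p j k *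
      dir (fun q => hSymmComp φ N E q j k) p (E i p)) := by
    rw [e, dir_sum fun j _ => DiffAt.sum fun k _ => (hd j k).mul (hd j k)]
    refine Finset.sum_congr rfl fun j _ => ?_
    rw [dir_sum fun k _ => (hd j k).mul (hd j k)]
    refine Finset.sum_congr rfl fun k _ => ?_
    rw [dir_mul (hd j k) (hd j k)]
    ring
  have hzero : ∑ j, ∑ k, hSymmComp φ N E p j k *
      ∑ l, christoffel φ E p i j l * hSymmComp φ N E p l k = 0 := by
    have h1 := ip2_eq_zero_of_symm_antisymm
      (A := fun j l => ∑ k, hSymmComp φ N E p j k * hSymmComp φ N E p l k)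
      (B := fun j l => christoffel φ E p i j l)
      (fun j l => Finset.sum_congr rfl fun k _ => mul_comm _ _)
      (fun j l => hL.christoffel_antisymm hφ hp i j l)
    rw [← h1, ip2]
    refine Finset.sum_congr rfl fun j _ => ?_
    simp only [Finset.mul_sum, Finset.sum_mul]
    rw [Finset.sum_comm]
    exact Finset.sum_congr rfl fun _ _ => Finset.sum_congr rfl fun _ _ => by ring
  have hzero' : ∑ j, ∑ k, hSymmComp φ N E p j k *
      ∑ l, christoffel φ E p i k l * hSymmComp φ N E p j l = 0 := by
    rw [Finset.sum_comm, ← hzero]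
    refine Finset.sum_congr rfl fun k _ => Finset.sum_congr rfl fun j _ => ?_
    rw [hL.hSymmComp_symm hφ hp j k]
    congr 1
    exact Finset.sum_congr rfl fun l _ => by rw [hL.hSymmComp_symm hφ hp j l]
  rw [hdir]
  simp only [← Finset.mul_sum]
  congr 1
  simp only [ip2, hL.nablaComp_eq hφ hp hn, mul_sub, Finset.sum_sub_distrib, hzero, hzero',
    sub_zero]

theorem IsLocalFrame.inner_dir_nu_frame_deriv (hn : 0 < n) (i j k) :
    inner ℝ (dir (nu N) p (E j p)) (dir (frameVec φ E k) p (E i p)) =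
      ∑ l, christoffel φ E p i k l * hComp φ N E p j l := by
  rw [hL.parseval hφ hp hn, hL.dir_nu_nu hφ hp, hL.dir_nu_T hφ hp, zero_mul, zero_mul, add_zero,
    add_zero]
  exact Finset.sum_congr rfl fun l _ => mul_comm _ _

theorem IsLocalFrame.dir_hComp (hn : 0 < n) (i j k) :
    dir (fun q => hComp φ N E q j k) p (E i p) =
      inner ℝ (dir (fun q => dir (nu N) q (E j q)) p (E i p)) (frameVec φ E k p) +
        ∑ l, christoffel φ E p i k l * hComp φ N E p j l := by
  have h := dir_inner (hL.dir_nu_diffAt hφ hp j) (hL.frame_diffAt hφ hp k) (E i p)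
  rw [hL.inner_dir_nu_frame_deriv hφ hp hn] at h
  exact h

theorem IsLocalFrame.inner_J_frame_deriv (hn : 0 < n) (i j k) :
    inner ℝ (J (frameVec φ E j p)) (dir (frameVec φ E k) p (E i p)) =
      (∑ l, christoffel φ E p i k l * jComp φ E p j l) +
        hComp φ N E p i k * jnuComp φ N E p j := by
  rw [hL.parseval hφ hp hn, inner_J_T, inner_J_frame_nu (N := N), hL.dir_frame_nu hφ hp, zero_mul,
    add_zero]
  simp only [christoffel, jComp, hComp, mul_comm]
  ring

theorem IsLocalFrame.jComp_diffAt (j k) : DiffAt n (fun q => jComp φ E q j k) p :=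
  ((hL.frame_diffAt hφ hp j).clm JL).inner (hL.frame_diffAt hφ hp k)

/-- `J` is parallel but its compression to `𝓗 TS` is not: the last two terms come from the
`ν`-components of the derivatives of the frame. -/
theorem IsLocalFrame.dir_jComp (hn : 0 < n) (i j k) :
    dir (fun q => jComp φ E q j k) p (E i p) =
      (∑ l, christoffel φ E p i j l * jComp φ E p l k) +
      (∑ l, christoffel φ E p i k l * jComp φ E p j l) -
      hComp φ N E p i j * jnuComp φ N E p k + hComp φ N E p i k * jnuComp φ N E p j := by
  have h : dir (fun q => jComp φ E q j k) p (E i p) = _ :=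
    dir_inner ((hL.frame_diffAt hφ hp j).clm JL) (hL.frame_diffAt hφ hp k) (E i p)
  rw [dir_clm JL (hL.frame_diffAt hφ hp j), JL_apply, JL_apply, inner_J_left,
    real_inner_comm (J (frameVec φ E k p)), hL.inner_J_frame_deriv hφ hp hn,
    hL.inner_J_frame_deriv hφ hp hn] at h
  have e : ∑ l, christoffel φ E p i j l * jComp φ E p k l =
      -∑ l, christoffel φ E p i j l * jComp φ E p l k := by
    rw [← Finset.sum_neg_distrib]
    exact Finset.sum_congr rfl fun l _ => by rw [jComp_antisymm k l]; ring
  rw [h, e]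
  ring

theorem IsLocalFrame.hComp_diffAt (j k) : DiffAt n (fun q => hComp φ N E q j k) p :=
  (hL.dir_nu_diffAt hφ hp j).inner (hL.frame_diffAt hφ hp k)

/-- The covariant derivative of `h̃` in terms of the second derivative of `ν`. -/
theorem IsLocalFrame.nablaComp_eq' (hn : 0 < n) (i j k) : nablaComp φ N E p i j k =
    inner ℝ (dir (fun q => dir (nu N) q (E j q)) p (E i p)) (frameVec φ E k p) -
      (∑ l, christoffel φ E p i j l * hComp φ N E p l k) +
      dir (alpha N) p (E i p) * jComp φ E p j k +
      alpha N p * (hComp φ N E p i k * jnuComp φ N E p j -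
        hComp φ N E p i j * jnuComp φ N E p k) := by
  have h1 : dir (fun q => hSymmComp φ N E q j k) p (E i p) =
      dir (fun q => hComp φ N E q j k) p (E i p) +
        (dir (alpha N) p (E i p) * jComp φ E p j k +
          alpha N p * dir (fun q => jComp φ E q j k) p (E i p)) := by
    rw [dir_congr hL.isOpen hp fun q hq => hL.hSymmComp_eq hq j k,
      dir_add (hL.hComp_diffAt hφ hp j k)
        ((hL.alpha_diffAt hφ hp).mul (hL.jComp_diffAt hφ hp j k)),
      dir_mul (hL.alpha_diffAt hφ hp) (hL.jComp_diffAt hφ hp j k)]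
  rw [hL.nablaComp_eq hφ hp hn, h1, hL.dir_hComp hφ hp hn, hL.dir_jComp hφ hp hn]
  simp only [hL.hSymmComp_eq hp, mul_add, Finset.sum_add_distrib]
  have e : ∀ a b : Fin (2 * n - 1) → ℝ, ∑ l, a l * (alpha N p * b l) =
      alpha N p * ∑ l, a l * b l := fun a b => by
    rw [Finset.mul_sum]
    exact Finset.sum_congr rfl fun l _ => by ring
  rw [e, e]
  ring

/-- The tangent vector `α ν - T`. -/
theorem IsLocalFrame.exists_transverse :
    ∃ V : TS n p, push φ p V = alpha N p • nu N p - T ∧ ∀ k,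
      inner ℝ (dir (nu N) p V) (frameVec φ E k p) =
        -dir (alpha N) p (E k p) - 2 * alpha N p ^ 2 * jnuComp φ N E p k := by
  have hT : inner ℝ T (nu N p) = 0 := by
    rw [real_inner_comm, inner_nu_T]
  obtain ⟨V, hV⟩ := exists_push_eq_of_inner hφ hL.normal hp
    (w := alpha N p • nu N p - T) (by
      rw [inner_sub_right, inner_sub_right, inner_smul_right, inner_smul_right,
        hL.nu_nu hφ hp, inner_nu_T, hT, inner_T_T]
      ring) (hL.horNormal_ne hφ p hp)
  refine ⟨V, hV, fun k => ?_⟩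
  -- The structure equation for the pair `E_k`, `V` trades the unknown derivative of `ν` along `V`
  -- for the derivative of `α` along `E_k`.
  have h := structure_equation hφ hL.isOpen hL.normal (hL.horNormal_ne hφ) hp (E k p) V
  have hk : inner ℝ T (push φ p (E k p)) = 0 := by
    rw [real_inner_comm]
    exact hL.frame_T hp k
  have hJ : inner ℝ (J (push φ p (E k p))) (nu N p) = -jnuComp φ N E p k := inner_J_frame_nu k
  rw [hV, hk, inner_sub_right, inner_smul_right, hL.dir_nu_nu hφ hp, hL.dir_nu_T hφ hp,
    inner_sub_right, inner_smul_right, hT, inner_T_T, inner_sub_right, inner_smul_right, inner_J_T,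
    hJ] at h
  rw [frameVec]
  linarith

/-- The Codazzi equation for `h̃`. -/
theorem IsLocalFrame.codazzi (hn : 0 < n) (i j k) :
    nablaComp φ N E p i j k - nablaComp φ N E p j i k =
      -2 * jComp φ E p i j *
        (dir (alpha N) p (E k p) + 2 * alpha N p ^ 2 * jnuComp φ N E p k) +
      dir (alpha N) p (E i p) * jComp φ E p j k - dir (alpha N) p (E j p) * jComp φ E p i k +
      alpha N p * (hComp φ N E p i k * jnuComp φ N E p j -
        hComp φ N E p j k * jnuComp φ N E p i +
        2 * alpha N p * jComp φ E p i j * jnuComp φ N E p k) := by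
  obtain ⟨V, hV, hVk⟩ := hL.exists_transverse hφ hp
  obtain ⟨Z, hZ, hZ2⟩ := dir_push_sub hφ (hL.coordinates_diffAt hp i) (hL.coordinates_diffAt hp j)
  -- The coefficients of `ν` in a parallel frame are plain functions, so second derivatives commute
  -- up to the bracket `Z` with no curvature term.
  have hdν := hZ _ (nu N) U hL.isOpen hp (smoothOn_nu hL.normal (hL.horNormal_ne hφ))
  have hfr : ∀ i j, dir (fun q => push φ q (E j q)) p (E i p) =
      (∑ k, christoffel φ E p i j k • push φ p (E k p)) - hComp φ N E p i j • nu N p :=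
    fun i j => by
      have h : dir (frameVec φ E j) p (E i p) = _ :=
        hL.expand hφ hp hn (dir (frameVec φ E j) p (E i p))
      rw [hL.dir_frame_T hφ hp, hL.dir_frame_nu hφ hp, zero_smul, add_zero, neg_smul,
        ← sub_eq_add_neg] at h
      exact h
  -- The torsion pushes the bracket of two horizontal fields out of `𝓗 TS`; the extra component is
  -- along `α ν - T`, whose `ν`-part absorbs the asymmetry of `h`.
  have hZ3 : Z = (∑ l, (christoffel φ E p i j l - christoffel φ E p j i l) • E l p) +
      (2 * jComp φ E p i j) • V := by
    apply push_injective hφ p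
    rw [map_add, map_sum, map_smul, hV]
    simp only [map_smul, map_sub, sub_smul, Finset.sum_sub_distrib]
    rw [hfr, hfr] at hZ2
    have h1 := hL.hComp_sub hφ hp i j
    have h2 : hComp φ N E p j i = hComp φ N E p i j + 2 * alpha N p * jComp φ E p i j := by
      linarith
    have h3 : inner ℝ (J (push φ p (E i p))) (push φ p (E j p)) = jComp φ E p i j := rfl
    rw [h2, h3] at hZ2
    rw [← sub_eq_iff_eq_add] at hZ2
    rw [← hZ2]
    module
  have hkey : inner ℝ (dir (nu N) p Z) (frameVec φ E k p) =
      (∑ l, christoffel φ E p i j l * hComp φ N E p l k) -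
        (∑ l, christoffel φ E p j i l * hComp φ N E p l k) +
        2 * jComp φ E p i j * (-dir (alpha N) p (E k p) -
          2 * alpha N p ^ 2 * jnuComp φ N E p k) := by
    rw [hZ3, dir_add_vec, dir_sum_vec, dir_smul_vec, inner_add_left, real_inner_smul_left, hVk,
      sum_inner, ← Finset.sum_sub_distrib]
    congr 1
    exact Finset.sum_congr rfl fun l _ => by
      rw [dir_smul_vec, real_inner_smul_left, sub_mul]
      rfl
  rw [← hdν, inner_sub_left] at hkey
  rw [hL.nablaComp_eq' hφ hp hn, hL.nablaComp_eq' hφ hp hn]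
  have h1 := hL.hComp_sub hφ hp i j
  linear_combination hkey - alpha N p * jnuComp φ N E p k * h1

theorem IsLocalFrame.jnuComp_diffAt (k) : DiffAt n (fun q => jnuComp φ N E q k) p :=
  ((hL.nu_diffAt hφ hp).clm JL).inner (hL.frame_diffAt hφ hp k)

/-- `J` commutes with the ambient connection, so the covariant derivative of `J(ν)` is `J` of the
derivative of `ν`, compressed to `𝓗 TS`. -/
theorem IsLocalFrame.dir_jnuComp (hn : 0 < n) (i k) :
    dir (fun q => jnuComp φ N E q k) p (E i p) =
      (∑ l, christoffel φ E p i k l * jnuComp φ N E p l) +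
        ∑ s, hComp φ N E p i s * jComp φ E p s k := by
  have h : dir (fun q => jnuComp φ N E q k) p (E i p) = _ :=
    dir_inner ((hL.nu_diffAt hφ hp).clm JL) (hL.frame_diffAt hφ hp k) (E i p)
  have h1 := hL.parseval hφ hp hn (dir (nu N) p (E i p)) (J (frameVec φ E k p))
  have h2 := hL.parseval hφ hp hn (J (nu N p)) (dir (frameVec φ E k) p (E i p))
  rw [inner_J_T, hL.dir_nu_nu hφ hp, zero_mul, mul_zero, add_zero, add_zero] at h1
  rw [inner_J_T, inner_J_nu_nu, zero_mul, zero_mul, add_zero, add_zero] at h2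
  rw [dir_clm JL (hL.nu_diffAt hφ hp), JL_apply, JL_apply, inner_J_left, h1, h2] at h
  rw [h, add_comm, ← Finset.sum_neg_distrib]
  congr 1
  · exact Finset.sum_congr rfl fun l _ => mul_comm _ _
  · refine Finset.sum_congr rfl fun s _ => ?_
    rw [jComp_antisymm s k]
    exact (mul_neg _ _).symm

/-! ### Consequences of minimality and of the two special properties -/

omit hφ in
theorem IsLocalFrame.trace_hSymmComp (hH : IsMinimal φ) : ∑ j, hSymmComp φ N E p j j = 0 := by
  have h := hH U N E hL p hp
  rw [← h]
  refine Finset.sum_congr rfl fun j _ => ?_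
  have := jComp_antisymm (φ := φ) (E := E) (p := p) j j
  have h0 : jComp φ E p j j = 0 := by linarith
  rw [hL.hSymmComp_eq hp, h0, mul_zero, add_zero]
  rfl

/-- The trace commutes with the covariant derivative, and the trace of `h̃` vanishes on all of `U`.
-/
theorem IsLocalFrame.trace_nablaComp (hn : 0 < n) (hH : IsMinimal φ) (i) :
    ∑ j, nablaComp φ N E p i j j = 0 := by
  have h1 : ∑ j, dir (fun q => hSymmComp φ N E q j j) p (E i p) = 0 := by
    rw [← dir_sum fun j _ => hL.hSymmComp_diffAt hφ hp j j,
      dir_congr hL.isOpen hp fun q hq => hL.trace_hSymmComp hq hH]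
    exact dir_const _ _ _
  have h2 : ∑ j, ∑ l, christoffel φ E p i j l * hSymmComp φ N E p l j = 0 := by
    have := ip2_eq_zero_of_symm_antisymm (A := hSymmComp φ N E p) (B := christoffel φ E p i)
      (hL.hSymmComp_symm hφ hp) (fun j l => hL.christoffel_antisymm hφ hp i j l)
    rw [← this, ip2]
    refine Finset.sum_congr rfl fun j _ => Finset.sum_congr rfl fun l _ => ?_
    rw [hL.hSymmComp_symm hφ hp l j, mul_comm]
  have h3 : ∑ j, ∑ l, christoffel φ E p i j l * hSymmComp φ N E p j l = 0 := by
    rw [← h2]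
    exact Finset.sum_congr rfl fun j _ => Finset.sum_congr rfl fun l _ => by
      rw [hL.hSymmComp_symm hφ hp l j]
  simp only [hL.nablaComp_eq hφ hp hn, Finset.sum_sub_distrib, h1, h2, h3, sub_zero]

theorem IsLocalFrame.nablaComp_symm (hn : 0 < n) (i j k) :
    nablaComp φ N E p i j k = nablaComp φ N E p i k j := by
  have h : dir (fun q => hSymmComp φ N E q j k) p (E i p) =
      dir (fun q => hSymmComp φ N E q k j) p (E i p) :=
    dir_congr hL.isOpen hp (fun q hq => hL.hSymmComp_symm hφ hq j k) _
  rw [hL.nablaComp_eq hφ hp hn, hL.nablaComp_eq hφ hp hn, h]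
  have h1 : ∀ a b, ∑ l, christoffel φ E p i a l * hSymmComp φ N E p l b =
      ∑ l, christoffel φ E p i a l * hSymmComp φ N E p b l := fun a b =>
    Finset.sum_congr rfl fun l _ => by rw [hL.hSymmComp_symm hφ hp l b]
  rw [h1, h1]
  ring

/-- (P1) says this for `h` contracted in its first slot; `h` may be replaced by `h̃` because `ω`
kills `J(ν)`, and then symmetry exchanges the slots. -/
theorem IsLocalFrame.hSymmComp_jnuComp (hn : 0 < n) (h1 : P1 φ) (j) :
    ∑ k, hSymmComp φ N E p j k * jnuComp φ N E p k = ell φ N p * jnuComp φ N E p j := by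
  have h := sub_eq_zero.1 (h1 U N E hL p hp)
  rw [cov, hL.Jnu_eq hφ hp hn, dir_sum_vec] at h
  have h2 := congrArg (fun v => inner ℝ v (frameVec φ E j p)) h
  simp only [sum_inner, dir_smul_vec, real_inner_smul_left] at h2
  have h3 : ∑ k, jnuComp φ N E p k * hComp φ N E p k j = ell φ N p * jnuComp φ N E p j := h2
  rw [← h3]
  have h4 : ∑ k, alpha N p * (jComp φ E p j k * jnuComp φ N E p k) = 0 := by
    rw [← Finset.mul_sum, hL.jComp_jnuComp hφ hp hn, mul_zero]
  rw [← sub_eq_zero, ← Finset.sum_sub_distrib, ← neg_eq_zero, ← Finset.sum_neg_distrib, ← h4]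
  refine Finset.sum_congr rfl fun k _ => ?_
  rw [hL.hSymmComp_symm hφ hp, hL.hSymmComp_eq hp, jComp_antisymm k j]
  ring

/-- The covariant derivative of the eigenvector equation `h̃(·, J(ν)) = ℓ ⟨J(ν), ·⟩`. -/
theorem IsLocalFrame.nablaComp_jnuComp (hn : 0 < n) (h1 : P1 φ) (i j) :
    ∑ k, nablaComp φ N E p i j k * jnuComp φ N E p k =
      dir (ell φ N) p (E i p) * jnuComp φ N E p j +
      ell φ N p * (∑ s, hComp φ N E p i s * jComp φ E p s j) -
      ∑ k, hSymmComp φ N E p j k * (∑ s, hComp φ N E p i s * jComp φ E p s k) := by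
  have hz := fun k => hL.jnuComp_diffAt hφ hp k
  have hB := fun j k => hL.hSymmComp_diffAt hφ hp j k
  -- Differentiability of `ℓ` is read off from `ℓ = h̃(J(ν), J(ν))`, a polynomial in differentiable
  -- components.
  have hell : DiffAt n (ell φ N) p := by
    have hs : DiffAt n (fun q => ∑ j, (∑ k, hSymmComp φ N E q j k * jnuComp φ N E q k) *
        jnuComp φ N E q j) p :=
      DiffAt.sum fun j _ => (DiffAt.sum fun k _ => (hB j k).mul (hz k)).mul (hz j)
    refine hs.congr_of_eventuallyEq (Filter.eventually_of_mem (hL.isOpen.mem_nhds hp)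
      fun q hq => ?_)
    simp only [hL.hSymmComp_jnuComp hφ hq hn h1, mul_assoc, ← Finset.mul_sum,
      hL.jnuComp_sq hφ hq hn, mul_one]
  have hd : dir (fun q => ∑ k, hSymmComp φ N E q j k * jnuComp φ N E q k) p (E i p) =
      dir (fun q => ell φ N q * jnuComp φ N E q j) p (E i p) :=
    dir_congr hL.isOpen hp (fun q hq => hL.hSymmComp_jnuComp hφ hq hn h1 j) _
  rw [dir_sum fun k _ => (hB j k).mul (hz k), dir_mul hell (hz j)] at hd
  simp only [dir_mul (hB _ _) (hz _), hL.dir_jnuComp hφ hp hn] at hd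
  have hc : ∀ k, dir (fun q => hSymmComp φ N E q j k) p (E i p) = nablaComp φ N E p i j k +
      (∑ l, christoffel φ E p i j l * hSymmComp φ N E p l k) +
      ∑ l, christoffel φ E p i k l * hSymmComp φ N E p j l := fun k => by
    rw [hL.nablaComp_eq hφ hp hn]
    ring
  simp only [hc, add_mul, mul_add, Finset.sum_add_distrib] at hd
  have e1 : ∑ k, (∑ l, christoffel φ E p i j l * hSymmComp φ N E p l k) * jnuComp φ N E p k =
      ell φ N p * ∑ l, christoffel φ E p i j l * jnuComp φ N E p l := by
    simp only [Finset.sum_mul]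
    rw [Finset.sum_comm]
    simp only [mul_assoc, ← Finset.mul_sum, hL.hSymmComp_jnuComp hφ hp hn h1]
    rw [Finset.mul_sum]
    exact Finset.sum_congr rfl fun l _ => by ring
  have e2 : ∑ k, (∑ l, christoffel φ E p i k l * hSymmComp φ N E p j l) * jnuComp φ N E p k =
      -∑ k, hSymmComp φ N E p j k * ∑ l, christoffel φ E p i k l * jnuComp φ N E p l := by
    simp only [Finset.sum_mul, Finset.mul_sum]
    rw [Finset.sum_comm, ← Finset.sum_neg_distrib]
    refine Finset.sum_congr rfl fun k _ => ?_
    rw [← Finset.sum_neg_distrib]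
    refine Finset.sum_congr rfl fun l _ => ?_
    rw [hL.christoffel_antisymm hφ hp i l k]
    ring
  rw [e1, e2] at hd
  linarith

theorem IsLocalFrame.dir_alpha (hn : 0 < n) (h2 : P2 φ) (i) :
    dir (alpha N) p (E i p) = dir (alpha N) p (Jnu φ N p) * jnuComp φ N E p i := by
  have h := h2 U N E hL p hp
  have hJ : push φ p (Jnu φ N p) = J (nu N p) := by
    have h3 := hL.expand hφ hp hn (J (nu N p))
    rw [inner_J_nu_nu, inner_J_T, zero_smul, zero_smul, add_zero, add_zero] at h3
    rw [hL.Jnu_eq hφ hp hn, map_sum]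
    refine Eq.trans ?_ h3.symm
    exact Finset.sum_congr rfl fun k _ => by rw [map_smul]; rfl
  have h4 := congrArg (fun X => inner ℝ (push φ p X) (frameVec φ E i p)) h
  simp only [map_smul, hJ, real_inner_smul_left, gradHS, map_sum, sum_inner] at h4
  have h5 : ∀ j, inner ℝ (push φ p (E j p)) (frameVec φ E i p) = idm j i := fun j =>
    hL.frame_frame hp j i
  simp only [h5, idm, mul_ite, mul_one, mul_zero, Finset.sum_ite_eq', Finset.mem_univ,
    if_true] at h4
  exact h4

theorem IsLocalFrame.kato (hn : 0 < n) :
    normSqGradHS φ E (normSqHSymm φ N E) p ≤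
      4 * normSqHSymm φ N E p * normSqNablaHSymm φ N E p := by
  have hB : normSqHSymm φ N E p = ip2 (hSymmComp φ N E p) (hSymmComp φ N E p) := by
    simp only [normSqHSymm, ip2, hSymmComp, sq]
  have hC : normSqNablaHSymm φ N E p = ip3 (nablaComp φ N E p) (nablaComp φ N E p) := by
    simp only [normSqNablaHSymm, ip3, ip2, nablaComp, sq]
  rw [hL.normSqGradHS_eq hp, hB, hC, ip3, Finset.mul_sum]
  refine Finset.sum_le_sum fun i _ => ?_
  rw [hL.dir_normSqHSymm hφ hp hn]
  have := ip2_sq_le (hSymmComp φ N E p) (nablaComp φ N E p i)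
  linarith

theorem IsLocalFrame.improved_kato (hn : 0 < n) (hH : IsMinimal φ) (h1 : P1 φ) (h2 : P2 φ) {k : ℝ}
    (hk : k ∈ Set.Icc (0 : ℝ) 2) :
    (1 + k / (2 * n - 1)) * normSqGradHS φ E (normSqHSymm φ N E) p ≤
      4 * normSqHSymm φ N E p * normSqNablaHSymm φ N E p +
        4 * alpha N p ^ 2 * normSqHSymm φ N E p * ((4 * k - 2) * normSqHSymm φ N E p +
          (2 + 2 * k * n - 2 * k - 4 * n) * ell φ N p ^ 2) := by
  have hB : normSqHSymm φ N E p = ip2 (hSymmComp φ N E p) (hSymmComp φ N E p) := by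
    simp only [normSqHSymm, ip2, hSymmComp, sq]
  have hC : normSqNablaHSymm φ N E p = ip3 (nablaComp φ N E p) (nablaComp φ N E p) := by
    simp only [normSqNablaHSymm, ip3, ip2, nablaComp, sq]
  have hgrad : normSqGradHS φ E (normSqHSymm φ N E) p =
      4 * ∑ i, ip2 (hSymmComp φ N E p) (nablaComp φ N E p i) *
        ip2 (hSymmComp φ N E p) (nablaComp φ N E p i) := by
    rw [hL.normSqGradHS_eq hp, Finset.mul_sum]
    exact Finset.sum_congr rfl fun i _ => by rw [hL.dir_normSqHSymm hφ hp hn]; ring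
  rw [hgrad, hB, hC]
  have htr := hL.trace_hSymmComp hp hH
  -- For `n = 1` the space `𝓗 TS` is a line, so a trace-free `h̃` is zero and both sides vanish; the
  -- pointwise inequality needs rank at least two.
  obtain rfl | hn2 := Nat.eq_or_lt_of_le (Nat.succ_le_of_lt hn)
  · have h0 : hSymmComp φ N E p = 0 := by
      ext i j
      have hi : i = (0 : Fin 1) := Subsingleton.elim (α := Fin 1) _ _
      have hj : j = (0 : Fin 1) := Subsingleton.elim (α := Fin 1) _ _
      subst hi hj
      exact (Fin.sum_univ_one (fun j : Fin 1 => hSymmComp φ N E p j j)).symm.trans htr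
    simp [h0, ip2]
  · have hcard : Fintype.card (Fin (2 * n - 1)) = 2 * n - 1 := Fintype.card_fin _
    have hcardR : ((Fintype.card (Fin (2 * n - 1)) : ℕ) : ℝ) = 2 * n - 1 := by
      rw [hcard, Nat.cast_sub (by omega)]
      push_cast
      ring
    have hcomp : ∀ i s, hSymmComp φ N E p i s - alpha N p * jComp φ E p i s =
        hComp φ N E p i s := fun i s => by
      rw [hL.hSymmComp_eq hp]
      ring
    have key := improved_kato_pointwise (B := hSymmComp φ N E p) (om := jComp φ E p)
      (C := nablaComp φ N E p) (z := jnuComp φ N E p) (lam := fun i => dir (ell φ N) p (E i p))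
      -- The summand `α²` in `b` collects the transverse derivative of `ν` and the terms from
      -- replacing `h` by `h̃ - α ω` in the Codazzi equation.
      (a := alpha N p) (b := dir (alpha N) p (Jnu φ N p) + alpha N p ^ 2) (l := ell φ N p) (k := k)
      (by rw [hcard]; omega) hk (hL.hSymmComp_symm hφ hp) htr jComp_antisymm
      (hL.jComp_sq hφ hp hn) (hL.jComp_jnuComp hφ hp hn) (hL.jnuComp_sq hφ hp hn)
      (hL.hSymmComp_jnuComp hφ hp hn h1) (hL.nablaComp_symm hφ hp hn)
      (hL.trace_nablaComp hφ hp hn hH)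
      (fun i j k => by
        rw [hL.codazzi hφ hp hn, hL.dir_alpha hφ hp hn h2 i, hL.dir_alpha hφ hp hn h2 j,
          hL.dir_alpha hφ hp hn h2 k, ← hcomp, ← hcomp]
        ring)
      (fun i j => by
        simp only [hcomp]
        exact hL.nablaComp_jnuComp hφ hp hn h1 i j)
    rw [hcardR] at key
    linarith

end Codazzi

end Heisenberg

theorem theorem1p3 {n : ℕ} {M : Type*} [TopologicalSpace M]
    [ChartedSpace (EuclideanSpace ℝ (Fin (2 * n))) M] [IsManifold (𝓡 (2 * n)) ∞ M]
    (φ : M → Heisenberg.Point n) (hφ : Heisenberg.IsImmersedHypersurface φ) :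
    (∀ U N E, Heisenberg.IsLocalFrame φ U N E → ∀ p ∈ U,
      Heisenberg.normSqGradHS φ E (Heisenberg.normSqHSymm φ N E) p ≤
        4 * Heisenberg.normSqHSymm φ N E p * Heisenberg.normSqNablaHSymm φ N E p) ∧
    (Heisenberg.IsMinimal φ → Heisenberg.P1 φ → Heisenberg.P2 φ →
      ∀ k ∈ Set.Icc (0 : ℝ) 2, ∀ U N E, Heisenberg.IsLocalFrame φ U N E → ∀ p ∈ U,
        (1 + k / (2 * n - 1)) *
            Heisenberg.normSqGradHS φ E (Heisenberg.normSqHSymm φ N E) p ≤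
          4 * Heisenberg.normSqHSymm φ N E p * Heisenberg.normSqNablaHSymm φ N E p +
            4 * Heisenberg.alpha N p ^ 2 * Heisenberg.normSqHSymm φ N E p *
              ((4 * k - 2) * Heisenberg.normSqHSymm φ N E p +
                (2 + 2 * k * n - 2 * k - 4 * n) * Heisenberg.ell φ N p ^ 2)) := by
  -- For `n = 0` truncated subtraction makes the frame empty, so every sum over it is zero.
  obtain rfl | hn := Nat.eq_zero_or_pos n
  · have h0 : ∀ (N : M → Heisenberg.Vec 0)
        (E : Fin (2 * 0 - 1) → ∀ q : M, Heisenberg.TS 0 q) (p : M),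
        Heisenberg.normSqHSymm φ N E p = 0 := fun N E p =>
      Finset.sum_eq_zero fun i _ => Fin.elim0 i
    have h1 : ∀ (f : M → ℝ) (E : Fin (2 * 0 - 1) → ∀ q : M, Heisenberg.TS 0 q) (p : M),
        Heisenberg.normSqGradHS φ E f p = 0 := fun f E p => by
      have : Heisenberg.gradHS E f p = 0 := Finset.sum_eq_zero fun i _ => Fin.elim0 i
      rw [Heisenberg.normSqGradHS, this, map_zero, norm_zero]
      ring
    refine ⟨fun U N E _ p _ => ?_, fun _ _ _ k _ U N E _ p _ => ?_⟩
    · rw [h0, h1]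
      simp
    · rw [h0, h1]
      simp
  · exact ⟨fun U N E hL p hp => hL.kato hφ hp hn,
      fun hH h1 h2 k hk U N E hL p hp => hL.improved_kato hφ hp hn hH h1 h2 hk⟩
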